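/- **Setting.** There are $T$ rounds of single-item auctions, $K\ge 1$ bidders in each round, and $n$ bidders in total; a fixed schedule says who participates in which round, and each bidder participates in at most $\overline m$ rounds. All values (one for each bidder in each round in which she participates) are i.i.d. draws from a distribution $F$ on $\mathbb R_+$. Bids are non-negative. For $0\le c<1$ and samples $v_1\ge\dots\ge v_N\ge 0$, let $\mathrm{ERM}^c(v_1,\dots,v_N)=v_{i^*}$, where $i^*$ is the largest maximizer of $i\cdot v_i$ over $cN<i\le N$. The *two-phase ERM algorithm* with parameters $1\le T_1\le T$ and $c$ runs a truthful, prior-independent auction $\mathcal M$ (its outcome depends only on the bids of the round and on independent randomness of that round, and for any bids of the others it is optimal to bid one's value) in each of the first $T_1$ rounds. In each later round it runs a second price auction (a posted price if $K=1$) with reserve price $\mathrm{ERM}^c$ of all $T_1K$ bids of the first $T_1$ rounds. With $P=\mathrm{ERM}^c$, let $$\delta^{\mathrm{worst}}_m(v_{-I})=\sup_{v_I\in\mathbb R_+^m}\Big[1-\frac{\inf_{b_I\in\mathbb R_+^m}P(b_I,v_{-I})}{P(v_I,v_{-I})}\Big],\qquad \Delta^{\mathrm{worst}}_{N,m}=\mathbb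 E_{v_{-I}}\big[\delta^{\mathrm{worst}}_m(v_{-I})\big],$$ where $v_{-I}$ consists of $N-m$ i.i.d. draws from $F$ (and $\Delta^{\mathrm{worst}}_{N,m}=1$ if $m\ge N$). The history $h_i^t$ of bidder $i$ at the start of round $t$ consists of her own bid, whether she won, her payment, and any information that the auction disclosed to her, for each round before $t$ in which she participated. A strategy gives the bid in each round as a (measurable) function of the bidder's whole value profile $\boldsymbol v_i$ and her history. The algorithm is *$\epsilon$-perfect Bayesian incentive-compatible* ($\epsilon$-PBIC) if truthful bidding is an $\epsilon$-perfect Bayesian equilibrium: when the others bid truthfully, then for each bidder $i$, each round $t$, every value profile $\boldsymbol v_i$, and every history $h_i^t$ (also one that arises after earlier deviations of bidder $i$; up to a null set of histories, as conditional expectations are determined only up to null sets), no strategy gives bidder $i$ in rounds $t,\dots,T$ a total expected utility, conditional on $h_i^t$ and $\boldsymbol v_i$, that exceeds the one from bidding truthfully in rounds $t,\dots,T$ by more than $\epsilon$. **Theorem.** 1. *Bounded distributions.* If $F$ is supported in $[1,D]$ (and values range over $[1,D]$), then for every $c\in[0,1)$ the two-phase ERM algorithm is $\epsilon$-PBIC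 with $$\epsilon=\overline m\,D\,\Delta^{\mathrm{worst}}_{T_1K,\ \overline mK}.$$ 2. *MHR distributions.* Let $T_1,K,\overline m$ vary along a sequence with $\overline mK=o(\sqrt{T_1K})$. Then there are constants $C_1,C_2>0$ such that, from some point of the sequence on, for every $T\ge T_1$, every schedule, every such $\mathcal M$, every $c$ with $\frac{\overline m}{T_1}\le c\le\frac1{4e}$, and every $F$ with monotone hazard rate (that is, $F$ has a density $f$ such that $f(x)/(1-F(x))$ is non-decreasing on $\{x\ge 0: F(x)<1\}$), the two-phase ERM algorithm is $\epsilon$-PBIC (with values ranging over $\mathbb R_+$) with $$\epsilon=C_1\,\overline m\,v^*\,\Delta^{\mathrm{worst}}_{T_1K,\ \overline mK}+C_2\,\frac{\overline m\,v^*}{\sqrt{T_1K}},\qquad v^*=\operatorname{argmax}_v\{v[1-F(v)]\}.$$ In particular $C_1,C_2$ and the starting point do not depend on $F$ and $c$. -/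

import Mathlib

open MeasureTheory ProbabilityTheory Asymptotics Filter
open scoped NNReal ENNReal

noncomputable section

namespace RepAuction

/-! ### Empirical revenue maximization and the incentive-awareness measure -/

/-- The `i`-th largest element (`i = 1, 2, …`) of a finite multiset of samples. -/
def kthLargest (s : Multiset ℝ≥0) (i : ℕ) : ℝ≥0 :=
  (s.sort (· ≥ ·)).getD (i - 1) 0

/-- The indices `i` with `c N < i ≤ N`, where `N` is the number of samples. -/
def guardedIndices (c : ℝ) (s : Multiset ℝ≥0) : Finset ℕ := by
  classical
  exact (Finset.Icc 1 s.card).filter (fun i => c * (s.card : ℝ) < (i : ℝ))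

/-- The maximizers of `i * v_i` over `c N < i ≤ N`, for the sorted samples `v_1 ≥ v_2 ≥ … ≥ v_N`. -/
def optimalIndices (c : ℝ) (s : Multiset ℝ≥0) : Finset ℕ := by
  classical
  exact (guardedIndices c s).filter
    (fun i => ∀ j ∈ guardedIndices c s, (j : ℝ≥0) * kthLargest s j ≤ (i : ℝ≥0) * kthLargest s i)

/-- `c`-guarded empirical revenue maximization: the sample `v_{i*}`, where `i*` is the
largest maximizer of `i * v_i` over `c N < i ≤ N`. -/
def ERM (c : ℝ) (s : Multiset ℝ≥0) : ℝ≥0 :=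
  kthLargest s ((optimalIndices c s).sup id)

/-- The multiset consisting of the samples `a` and the samples `w`. -/
def pool {m k : ℕ} (a : Fin m → ℝ≥0) (w : Fin k → ℝ≥0) : Multiset ℝ≥0 :=
  Finset.univ.val.map a + Finset.univ.val.map w

/-- `δ_I(v_I, v_{-I}) = 1 - (inf over b_I of P(b_I, v_{-I})) / P(v_I, v_{-I})`
for a (symmetric) price learning function `P`. -/
def incentiveMeasure (P : Multiset ℝ≥0 → ℝ≥0) {m k : ℕ}
    (a : Fin m → ℝ≥0) (w : Fin k → ℝ≥0) : ℝ :=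
  1 - (⨅ b : Fin m → ℝ≥0, (P (pool b w) : ℝ)) / (P (pool a w) : ℝ)

/-- `δ^worst_m(v_{-I})`, the supremum of `δ_I(v_I, v_{-I})` over the `m` samples `v_I`.
(It always lies in `[0, 1]`.) -/
def worstIncentiveMeasure (P : Multiset ℝ≥0 → ℝ≥0) (m : ℕ) {k : ℕ} (w : Fin k → ℝ≥0) : ℝ :=
  ⨆ a : Fin m → ℝ≥0, incentiveMeasure P a w

/-- `Δ^worst_{N,m}`, the expectation of `δ^worst_m(v_{-I})` when `v_{-I}` consists of `N - m`
independent draws from `F`. (When `m ≥ N`, no draw is left and the value for `ERM` is `1`.) -/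
def worstDelta (P : Multiset ℝ≥0 → ℝ≥0) (F : Measure ℝ≥0) (N m : ℕ) : ℝ :=
  (∫⁻ w : Fin (N - m) → ℝ≥0, ENNReal.ofReal (worstIncentiveMeasure P m w)
    ∂(Measure.pi fun _ => F)).toReal

/-! ### Value distributions -/

/-- All values lie in `[1, D]`. -/
def IsBoundedDist (F : Measure ℝ≥0) (D : ℝ≥0) : Prop :=
  F (Set.Icc 1 D)ᶜ = 0

/-- Monotone hazard rate: `F` has a density `f` for which `f(x) / (1 - F(x))` is non-decreasing
where it is defined, that is, where `1 - F(x) > 0`. -/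
def IsMHR (F : Measure ℝ≥0) : Prop :=
  ∃ f : ℝ≥0 → ℝ≥0, Measurable f ∧
    F = ((volume : Measure ℝ).comap NNReal.toReal).withDensity (fun x => (f x : ℝ≥0∞)) ∧
    MonotoneOn (fun x => (f x : ℝ) / F.real (Set.Ioi x)) {x | 0 < F.real (Set.Ioi x)}

/-- `p` maximizes the expected revenue `v (1 - F(v))` of a posted price. -/
def IsMonopolyPrice (F : Measure ℝ≥0) (p : ℝ≥0) : Prop :=
  ∀ v : ℝ≥0, (v : ℝ) * F.real (Set.Ioi v) ≤ (p : ℝ) * F.real (Set.Ioi p)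

/-! ### Single auctions -/

/-- A single-item auction with `K` bidders. Its outcome is a function of the bids and of a
random seed, uniform on `[0, 1]`: the winner (if any), the payments, and any further
information that is disclosed to the bidder in each position. -/
structure Auction (K : ℕ) where
  winner : (Fin K → ℝ≥0) → unitInterval → Option (Fin K)
  pay : (Fin K → ℝ≥0) → unitInterval → Fin K → ℝ
  info : (Fin K → ℝ≥0) → unitInterval → Fin K → ℝ

/-- The outcome is a measurable function of bids and seed, and for given bids
the expected payments exist. -/
structure Auction.Regular {K : ℕ} (A : Auction K) : Prop where
  measurable_winner : ∀ k : Fin K,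
    MeasurableSet {x : (Fin K → ℝ≥0) × unitInterval | A.winner x.1 x.2 = some k}
  measurable_pay : ∀ k : Fin K,
    Measurable fun x : (Fin K → ℝ≥0) × unitInterval => A.pay x.1 x.2 k
  measurable_info : ∀ k : Fin K,
    Measurable fun x : (Fin K → ℝ≥0) × unitInterval => A.info x.1 x.2 k
  integrable_pay : ∀ (b : Fin K → ℝ≥0) (k : Fin K), Integrable fun s => A.pay b s k

/-- The utility, averaged over the randomness of the auction, of the bidder in position `k`
with value `v` when the bids are `b`. -/
def Auction.utility {K : ℕ} (A : Auction K) (v : ℝ≥0) (b : Fin K → ℝ≥0) (k : Fin K) : ℝ :=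
  ∫ s, ((if A.winner b s = some k then (v : ℝ) else 0) - A.pay b s k)

/-- Truthfulness: whatever the others bid, bidding one's value is optimal. -/
def Auction.Truthful {K : ℕ} (A : Auction K) : Prop :=
  ∀ (k : Fin K) (v : ℝ≥0) (b : Fin K → ℝ≥0),
    A.utility v b k ≤ A.utility v (Function.update b k v) k

/-- A rule, possibly randomized, that selects one of the highest bidders. -/
structure TieBreaking (K : ℕ) where
  top : (Fin K → ℝ≥0) → unitInterval → Fin K
  measurable_top : Measurable fun x : (Fin K → ℝ≥0) × unitInterval => top x.1 x.2
  le_top : ∀ (b : Fin K → ℝ≥0) (s : unitInterval) (j : Fin K), b j ≤ b (top b s)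

/-- The second price auction with reserve price `p` (for one bidder: the posted price `p`).
If the highest bid is at least `p`, a highest bidder wins and pays the maximum of `p` and of the
other bids. The reserve price is disclosed to the bidders. -/
def secondPrice {K : ℕ} (τ : TieBreaking K) (p : ℝ≥0) : Auction K where
  winner b s := if p ≤ b (τ.top b s) then some (τ.top b s) else none
  pay b s k := if p ≤ b (τ.top b s) ∧ k = τ.top b s then
      ((max p ((Finset.univ.erase k).sup b) : ℝ≥0) : ℝ) else 0
  info _ _ _ := p

/-! ### Repeated auctions

There are `T` rounds (numbered `0, …, T - 1`), each with `K` positions, and `n` bidders. -/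

/-- One number for every position of every round: the values, or the bids. -/
abbrev Table (T K : ℕ) := Fin T → Fin K → ℝ≥0

/-- Who participates in which round: `bidder r k` is the bidder in position `k` of round `r`.
The positions of a round are held by different bidders. -/
structure Schedule (n T K : ℕ) where
  bidder : Fin T → Fin K → Fin n
  injective : ∀ r, Function.Injective (bidder r)

/-- The rounds in which bidder `i` participates. -/
def Schedule.rounds {n T K : ℕ} (S : Schedule n T K) (i : Fin n) : Finset (Fin T) :=
  Finset.univ.filter (fun r => ∃ k, S.bidder r k = i)

/-- A seller's mechanism for repeated auctions: the auction that is run in each round, chosen as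
a function of the bids of the earlier rounds. -/
abbrev Mechanism (T K : ℕ) := Fin T → Table T K → Auction K

/-- The bids of the rounds before round `t`. -/
def before {T K : ℕ} (t : ℕ) (b : Table T K) : Table T K :=
  fun r k => if (r : ℕ) < t then b r k else 0

/-- What a participant observes in one round: her bid, whether she wins, her payment, and the
information disclosed to her. -/
abbrev Obs := ℝ≥0 × Bool × ℝ × ℝ

/-- A bidder's history: her observations in the positions that she held,
and a dummy value elsewhere. -/
abbrev History (T K : ℕ) := Fin T → Fin K → Obs

/-- A (measurable) strategy: the bid in round `r` as a function of the bidder's own value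
profile and of her history at the start of round `r`. -/
structure Strategy (T K : ℕ) where
  bid : Fin T → (Fin T → ℝ≥0) → History T K → ℝ≥0
  measurable_bid : ∀ r,
    Measurable fun x : (Fin T → ℝ≥0) × History T K => bid r x.1 x.2

/-- Bid the value of the current round. -/
def truthful (T K : ℕ) : Strategy T K where
  bid r v _ := v r
  measurable_bid r := (measurable_pi_apply r).comp measurable_fst

/-- Play `ρ` before round `t` and `σ` from round `t` on. -/
def Strategy.switch {T K : ℕ} (t : Fin T) (ρ σ : Strategy T K) : Strategy T K where
  bid r := if r < t then ρ.bid r else σ.bid r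
  measurable_bid r := by
    by_cases h : r < t
    · simpa [h] using ρ.measurable_bid r
    · simpa [h] using σ.measurable_bid r

/-- The value profile of bidder `i` in the table `x` of values (`0` where she does not
participate). -/
def Schedule.values {n T K : ℕ} (S : Schedule n T K) (x : Table T K) (i : Fin n) :
    Fin T → ℝ≥0 :=
  fun r => ∑ k, if S.bidder r k = i then x r k else 0

/-- The table of values in which bidder `i` has the value profile `v`, and the others the values
in `x`. -/
def Schedule.withValues {n T K : ℕ} (S : Schedule n T K) (i : Fin n) (v : Fin T → ℝ≥0)
    (x : Table T K) : Table T K :=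
  fun r k => if S.bidder r k = i then v r else x r k

/-- The history of bidder `i` at the start of round `t`, if the bids are `b` and the random
seeds of the auctions are `s`. -/
def Schedule.history {n T K : ℕ} (S : Schedule n T K) (G : Mechanism T K) (b : Table T K)
    (s : Fin T → unitInterval) (t : ℕ) (i : Fin n) : History T K :=
  fun r k =>
    if (r : ℕ) < t ∧ S.bidder r k = i then
      (b r k, decide ((G r (before r b)).winner (b r) (s r) = some k),
        (G r (before r b)).pay (b r) (s r) k, (G r (before r b)).info (b r) (s r) k)
    else (0, false, 0, 0)

/-- The bids in the first `t` rounds (`0` afterwards) when the values are `x`, the seeds are `s`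
and the bidders play the strategy profile `σ`. -/
def Schedule.play {n T K : ℕ} (S : Schedule n T K) (G : Mechanism T K)
    (σ : Fin n → Strategy T K) (x : Table T K) (s : Fin T → unitInterval) : ℕ → Table T K
  | 0 => fun _ _ => 0
  | t + 1 => fun r k =>
      if (r : ℕ) = t then
        (σ (S.bidder r k)).bid r (S.values x (S.bidder r k))
          (S.history G (S.play G σ x s t) s t (S.bidder r k))
      else S.play G σ x s t r k

/-- The total utility of bidder `i` in the rounds `t, t + 1, …`, if the values are `x` and the
bids are `b`, averaged over the randomness of the auction in each of these rounds. -/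
def Schedule.utilityFrom {n T K : ℕ} (S : Schedule n T K) (G : Mechanism T K) (x b : Table T K)
    (t : Fin T) (i : Fin n) : ℝ :=
  ∑ r ∈ Finset.univ.filter (fun r : Fin T => t ≤ r), ∑ k,
    if S.bidder r k = i then (G r (before r b)).utility (x r k) (b r) k else 0

/-! ### Perfect Bayesian equilibrium -/

/-- The primitive randomness: a value for every position of every round, and the seeds. -/
abbrev Draws (T K : ℕ) := Table T K × (Fin T → unitInterval)

/-- Values are independent draws from `F`, and the seeds are independent of them and of each
other. -/
def drawLaw (T K : ℕ) (F : Measure ℝ≥0) : Measure (Draws T K) :=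
  (Measure.pi fun _ : Fin T => Measure.pi fun _ : Fin K => F).prod
    (Measure.pi fun _ : Fin T => (volume : Measure unitInterval))

/-- The expectation of `f` in the extended reals (`⊥` if the negative part of `f` has infinite
expectation). -/
def extExpectation {Ω : Type*} [MeasurableSpace Ω] (μ : Measure Ω) (f : Ω → ℝ) : EReal :=
  ((∫⁻ ω, ENNReal.ofReal (f ω) ∂μ : ℝ≥0∞) : EReal) -
    ((∫⁻ ω, ENNReal.ofReal (-f ω) ∂μ : ℝ≥0∞) : EReal)

/-- The (random) history of bidder `i` at the start of round `t` when her value profile is `v`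
and the strategy profile `σ` is played. -/
def Schedule.randomHistory {n T K : ℕ} (S : Schedule n T K) (G : Mechanism T K)
    (σ : Fin n → Strategy T K) (i : Fin n) (v : Fin T → ℝ≥0) (t : Fin T) (ω : Draws T K) :
    History T K :=
  S.history G (S.play G σ (S.withValues i v ω.1) ω.2 t) ω.2 t i

/-- The belief of bidder `i` at the start of round `t`: the regular conditional distribution
(Bayes' rule) of all draws given her history, if her value profile is `v` and `σ` has been
played. -/
def Schedule.belief {n T K : ℕ} (S : Schedule n T K) (G : Mechanism T K) (F : Measure ℝ≥0)
    [IsProbabilityMeasure F] (σ : Fin n → Strategy T K) (i : Fin n) (v : Fin T → ℝ≥0)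
    (t : Fin T) : Kernel (History T K) (Draws T K) :=
  haveI : IsFiniteMeasure (drawLaw T K F) := by unfold drawLaw; infer_instance
  condDistrib id (S.randomHistory G σ i v t) (drawLaw T K F)

/-- The expected utility of bidder `i` in the rounds `t, t + 1, …`, given her value profile `v`
and her history `h` at the start of round `t`, when the others play according to `σ`, she has
played `ρ` before round `t`, and she plays `σ'` from round `t` on. -/
def Schedule.expectedUtilityFrom {n T K : ℕ} (S : Schedule n T K) (G : Mechanism T K)
    (F : Measure ℝ≥0) [IsProbabilityMeasure F] (σ : Fin n → Strategy T K) (i : Fin n)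
    (ρ σ' : Strategy T K) (v : Fin T → ℝ≥0) (t : Fin T) (h : History T K) : EReal :=
  extExpectation (S.belief G F (Function.update σ i ρ) i v t h) fun ω =>
    S.utilityFrom G (S.withValues i v ω.1)
      (S.play G (Function.update σ i (ρ.switch t σ')) (S.withValues i v ω.1) ω.2 T) t i

/-- `σ` is an `ε`-perfect Bayesian equilibrium, where values range over `V`: for every bidder `i`,
every round `t`, every value profile, and every history at `t` (including those which arise after
deviations `ρ` of bidder `i` from `σ i`; up to a set of histories of probability zero, on which
conditional expectations are not determined), no strategy `σ'` improves upon `σ i` from round `t`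
on by more than `ε`. -/
def Schedule.IsPBE {n T K : ℕ} (S : Schedule n T K) (G : Mechanism T K) (F : Measure ℝ≥0)
    [IsProbabilityMeasure F] (V : Set ℝ≥0) (σ : Fin n → Strategy T K) (ε : ℝ) : Prop :=
  ∀ (i : Fin n) (t : Fin T) (v : Fin T → ℝ≥0), (∀ r, v r ∈ V) →
    ∀ ρ : Strategy T K,
      ∀ᵐ h ∂((drawLaw T K F).map (S.randomHistory G (Function.update σ i ρ) i v t)),
        ∀ σ' : Strategy T K,
          S.expectedUtilityFrom G F σ i ρ σ' v t h - (ε : EReal) ≤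
            S.expectedUtilityFrom G F σ i ρ (σ i) v t h

/-- The mechanism is `ε`-perfect Bayesian incentive-compatible: truthful bidding is
an `ε`-perfect Bayesian equilibrium. -/
def Schedule.IsPBIC {n T K : ℕ} (S : Schedule n T K) (G : Mechanism T K) (F : Measure ℝ≥0)
    [IsProbabilityMeasure F] (V : Set ℝ≥0) (ε : ℝ) : Prop :=
  S.IsPBE G F V (fun _ => truthful T K) ε

/-! ### The two-phase algorithm -/

/-- The bids of the first `T₁` rounds. -/
def firstPhaseBids {T K : ℕ} (T₁ : ℕ) (b : Table T K) : Multiset ℝ≥0 :=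
  ((Finset.univ.filter fun r : Fin T => (r : ℕ) < T₁) ×ˢ
    (Finset.univ : Finset (Fin K))).val.map fun x => b x.1 x.2

/-- Two-phase ERM: run `M` in the first `T₁` rounds, and afterwards second price auctions whose
reserve price is `ERM^c` of all bids in the first `T₁` rounds. -/
def twoPhaseERM {T K : ℕ} (M : Auction K) (τ : TieBreaking K) (T₁ : ℕ) (c : ℝ) :
    Mechanism T K :=
  fun r b => if (r : ℕ) < T₁ then M else secondPrice τ (ERM c (firstPhaseBids T₁ b))

end RepAuction

end

noncomputable section

namespace RepAuction

/-! ### Order statistics and empirical revenue maximization -/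

/-! Both `M` and a second price auction with fixed reserve are truthful, so a deviation pays only by
lowering the reserve of later rounds. Fix a bidder and `m` first-phase rounds that include all of
hers. Let `w` be the bids of the other first-phase rounds, and `a`, `b` the bids of the chosen
rounds when she is truthful from now on and when she deviates. With P the price and δ =
`worstIncentiveMeasure`, a later round with value v gains at most min(v, P(a,w)) - P(b,w) ≤ min(v,
P(a,w)) δ(w) (`switchUtility_sub_le`, `min_sub_le_mul_worstIncentiveMeasure`).

During the first phase her history depends on nothing outside her own rounds
(`randomHistory_resample`). Hence replacing `w` by fresh draws preserves the conditional law of all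
draws given the history (`ae_condDistrib_id_eq_map_prod`), and the gain may be averaged over i.i.d.
`w`. All bids of her rounds count as manipulable because the history may reveal them. After the
first phase nothing can be gained. Bounding min(v, P) by D settles bounded distributions.

For MHR distributions, let p be the monopoly price and N the number of samples; it remains to bound
the mean of P(a,w) δ(w). The hazard rate is at most 2/p at p/2 and at least 1/(2p) beyond 2p, so p/4
is accepted with probability at least 1/2 and the moments of F are O(p^k). If P ≤ √N p, then
optimality of P against the price p/4, together with a bound on ∑ w_j², forces P ≤ 1280 p, except on
events of probability O(1/N). If P > √N p, the guard c ≥ m/T₁ makes some w_j at least P, so P ≤ ∑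
w_j⁴ / (√N p)³. Both exceptional cases contribute O(p/√N) on average (`ERM_pool_mul_le`,
`lintegral_priceExcess_le`). -/

theorem le_getD_iff_of_sorted {x : ℝ≥0} (hx : 0 < x) :
    ∀ (l : List ℝ≥0), l.Pairwise (· ≥ ·) → ∀ i : ℕ,
      x ≤ l.getD i 0 ↔ i < (l.filter (x ≤ ·)).length
  | [], _, i => ⟨fun h => absurd h (not_le.2 hx), fun h => absurd h (Nat.not_lt_zero _)⟩
  | a :: l, h, i => by
    rw [List.pairwise_cons] at h
    by_cases ha : x ≤ a
    · rw [List.filter_cons_of_pos (by simpa using ha)]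
      cases i with
      | zero => rw [List.getD_cons_zero]; simpa using ha
      | succ i => simpa using le_getD_iff_of_sorted hx l h.2 i
    · have h0 : l.filter (x ≤ ·) = [] := by
        rw [List.filter_eq_nil_iff]
        intro b hb hxb
        exact ha ((of_decide_eq_true hxb).trans (h.1 b hb))
      rw [List.filter_cons_of_neg (by simpa using ha), h0]
      cases i with
      | zero => rw [List.getD_cons_zero]; simpa using ha
      | succ i =>
        have := le_getD_iff_of_sorted hx l h.2 i
        rw [h0] at this
        simpa using this

/-- Turns order statistics into counts, the form used throughout. Positivity of `x` matters because
entries beyond the end default to 0. -/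
theorem le_kthLargest_iff {x : ℝ≥0} (hx : 0 < x) (s : Multiset ℝ≥0) {i : ℕ} (hi : 1 ≤ i) :
    x ≤ kthLargest s i ↔ i ≤ (s.filter (x ≤ ·)).card := by
  unfold kthLargest
  rw [le_getD_iff_of_sorted hx _ (Multiset.pairwise_sort s _)]
  have h : (s.filter (x ≤ ·)).card = ((s.sort (· ≥ ·)).filter (x ≤ ·)).length := by
    conv_lhs => rw [← Multiset.sort_eq s (· ≥ ·)]
    rw [Multiset.filter_coe, Multiset.coe_card]
  rw [h]
  omega

theorem mem_guardedIndices {c : ℝ} {s : Multiset ℝ≥0} {i : ℕ} :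
    i ∈ guardedIndices c s ↔ (1 ≤ i ∧ i ≤ s.card) ∧ c * (s.card : ℝ) < i := by
  simp [guardedIndices]

theorem mem_optimalIndices {c : ℝ} {s : Multiset ℝ≥0} {i : ℕ} :
    i ∈ optimalIndices c s ↔ i ∈ guardedIndices c s ∧ ∀ j ∈ guardedIndices c s,
      (j : ℝ≥0) * kthLargest s j ≤ (i : ℝ≥0) * kthLargest s i := by
  simp [optimalIndices]

/-- The last index is always guarded when c < 1. The estimates below use only that the chosen index
is guarded and maximal, not how ties are broken. -/
theorem exists_ERM_eq_kthLargest {c : ℝ} (hc : c < 1) {s : Multiset ℝ≥0} (hs : 0 < s.card) :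
    ∃ i ∈ guardedIndices c s, ERM c s = kthLargest s i ∧
      ∀ j ∈ guardedIndices c s, (j : ℝ≥0) * kthLargest s j ≤ (i : ℝ≥0) * kthLargest s i := by
  have hne : (guardedIndices c s).Nonempty := by
    refine ⟨s.card, mem_guardedIndices.2 ⟨⟨hs, le_rfl⟩, ?_⟩⟩
    have : (0 : ℝ) < s.card := by exact_mod_cast hs
    nlinarith
  obtain ⟨i, hi, hmax⟩ := (guardedIndices c s).exists_max_image
    (fun i => (i : ℝ≥0) * kthLargest s i) hne
  have hne' : (optimalIndices c s).Nonempty := ⟨i, mem_optimalIndices.2 ⟨hi, hmax⟩⟩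
  obtain ⟨j, hj, hj'⟩ := Finset.exists_mem_eq_sup _ hne' id
  obtain ⟨h1, h2⟩ := mem_optimalIndices.1 hj
  exact ⟨j, h1, by rw [ERM, hj']; rfl, h2⟩

theorem measurable_card_filter_le {ι : Type*} (t : Finset ι) (x : ℝ≥0) :
    Measurable fun b : ι → ℝ≥0 => ((t.val.map b).filter (x ≤ ·)).card := by
  classical
  have h : (fun b : ι → ℝ≥0 => ((t.val.map b).filter (x ≤ ·)).card) =
      fun b => ∑ i ∈ t, if x ≤ b i then 1 else 0 := by
    ext b
    rw [Multiset.filter_map, Multiset.card_map, Finset.sum_boole]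
    simp [Finset.card, Finset.filter]
  rw [h]
  refine Finset.measurable_sum _ fun i _ => Measurable.ite ?_ measurable_const measurable_const
  exact measurableSet_le measurable_const (measurable_pi_apply i)

theorem measurable_kthLargest {ι : Type*} (t : Finset ι) (i : ℕ) :
    Measurable fun b : ι → ℝ≥0 => kthLargest (t.val.map b) i := by
  have key : ∀ j, 1 ≤ j → Measurable fun b : ι → ℝ≥0 => kthLargest (t.val.map b) j := by
    intro j hj
    refine measurable_of_Ici fun x => ?_
    rcases eq_or_ne x 0 with rfl | h
    · have : Set.Ici (0 : ℝ≥0) = Set.univ := by ext y; simp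
      simp [this]
    · have : (fun b : ι → ℝ≥0 => kthLargest (t.val.map b) j) ⁻¹' Set.Ici x =
          {b | j ≤ ((t.val.map b).filter (x ≤ ·)).card} := by
        ext b
        exact le_kthLargest_iff (pos_iff_ne_zero.2 h) _ hj
      rw [this]
      exact measurableSet_le measurable_const (measurable_card_filter_le t x)
  -- By truncated subtraction, index 0 reads the same entry as index 1.
  rcases Nat.eq_zero_or_pos i with rfl | h
  · exact key 1 le_rfl
  · exact key i h

/-- The guarded indices depend only on the number of samples, so the set of maximizers takes
finitely many values, and on each of these events the price is a fixed order statistic. -/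
theorem measurable_ERM {ι : Type*} (t : Finset ι) (c : ℝ) :
    Measurable fun b : ι → ℝ≥0 => ERM c (t.val.map b) := by
  classical
  have hg : ∀ b : ι → ℝ≥0, guardedIndices c (t.val.map b) =
      guardedIndices c (t.val.map fun _ => 0) := by
    intro b
    simp [guardedIndices]
  set g := guardedIndices c (t.val.map fun _ => 0) with hgdef
  have hA : ∀ A : Finset ℕ, MeasurableSet {b : ι → ℝ≥0 | optimalIndices c (t.val.map b) = A} := by
    intro A
    have : {b : ι → ℝ≥0 | optimalIndices c (t.val.map b) = A} =
        {b | A ⊆ g} ∩ ⋂ i ∈ g, {b | i ∈ A ↔ ∀ j ∈ g, (j : ℝ≥0) * kthLargest (t.val.map b) j ≤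
          (i : ℝ≥0) * kthLargest (t.val.map b) i} := by
      ext b
      simp only [Set.mem_ofPred_eq, Set.mem_inter_iff, Set.mem_iInter, Finset.ext_iff,
        mem_optimalIndices, hg b]
      constructor
      · intro h
        refine ⟨fun i hi => ((h i).2 hi).1, fun i hi => ?_⟩
        rw [← h i]
        simp [hi]
      · rintro ⟨h1, h2⟩ i
        constructor
        · rintro ⟨hi, h3⟩
          exact (h2 i hi).2 h3
        · intro hi
          exact ⟨h1 hi, (h2 i (h1 hi)).1 hi⟩
    rw [this]
    refine (MeasurableSet.const _).inter (Finset.measurableSet_biInter _ fun i _ => ?_)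
    have h3 : MeasurableSet {b : ι → ℝ≥0 | ∀ j ∈ g, (j : ℝ≥0) * kthLargest (t.val.map b) j ≤
        (i : ℝ≥0) * kthLargest (t.val.map b) i} := by
      have : {b : ι → ℝ≥0 | ∀ j ∈ g, (j : ℝ≥0) * kthLargest (t.val.map b) j ≤
          (i : ℝ≥0) * kthLargest (t.val.map b) i} = ⋂ j ∈ g,
          {b | (j : ℝ≥0) * kthLargest (t.val.map b) j ≤
          (i : ℝ≥0) * kthLargest (t.val.map b) i} := by
        ext b; simp
      rw [this]
      exact Finset.measurableSet_biInter _ fun j _ => measurableSet_le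
        ((measurable_kthLargest t j).const_mul _) ((measurable_kthLargest t i).const_mul _)
    by_cases hi : i ∈ A
    · simpa [hi] using h3
    · have : {b : ι → ℝ≥0 | i ∈ A ↔ ∀ j ∈ g, (j : ℝ≥0) * kthLargest (t.val.map b) j ≤
          (i : ℝ≥0) * kthLargest (t.val.map b) i} = {b : ι → ℝ≥0 | ∀ j ∈ g, (j : ℝ≥0) *
          kthLargest (t.val.map b) j ≤ (i : ℝ≥0) * kthLargest (t.val.map b) i}ᶜ := by
        ext b; simp [hi]
      rw [this]
      exact h3.compl
  have hsum : (fun b : ι → ℝ≥0 => ERM c (t.val.map b)) = fun b => ∑ A ∈ g.powerset,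
      if optimalIndices c (t.val.map b) = A then kthLargest (t.val.map b) (A.sup id) else 0 := by
    ext b
    have hmem : optimalIndices c (t.val.map b) ∈ g.powerset := by
      rw [Finset.mem_powerset, ← hg b]
      intro i hi
      exact (mem_optimalIndices.1 hi).1
    rw [Finset.sum_eq_single_of_mem _ hmem]
    · simp [ERM]
    · intro A _ hne
      rw [if_neg (Ne.symm hne)]
  rw [hsum]
  exact Finset.measurable_sum _ fun A _ =>
    Measurable.ite (hA A) (measurable_kthLargest t _) measurable_const

/-! ### The incentive-awareness measure -/

theorem iInf_price_le (P : Multiset ℝ≥0 → ℝ≥0) {m k : ℕ} (b : Fin m → ℝ≥0) (w : Fin k → ℝ≥0) :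
    (⨅ b : Fin m → ℝ≥0, (P (pool b w) : ℝ)) ≤ P (pool b w) :=
  ciInf_le ⟨0, by rintro _ ⟨b, rfl⟩; exact NNReal.coe_nonneg _⟩ b

theorem iInf_price_nonneg (P : Multiset ℝ≥0 → ℝ≥0) {m k : ℕ} (w : Fin k → ℝ≥0) :
    0 ≤ ⨅ b : Fin m → ℝ≥0, (P (pool b w) : ℝ) :=
  le_ciInf fun _ => NNReal.coe_nonneg _

theorem incentiveMeasure_le_one (P : Multiset ℝ≥0 → ℝ≥0) {m k : ℕ} (a : Fin m → ℝ≥0)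
    (w : Fin k → ℝ≥0) : incentiveMeasure P a w ≤ 1 := by
  have := div_nonneg (iInf_price_nonneg P (m := m) w) (NNReal.coe_nonneg (P (pool a w)))
  unfold incentiveMeasure
  linarith

theorem incentiveMeasure_le_worst (P : Multiset ℝ≥0 → ℝ≥0) {m k : ℕ} (a : Fin m → ℝ≥0)
    (w : Fin k → ℝ≥0) : incentiveMeasure P a w ≤ worstIncentiveMeasure P m w :=
  le_ciSup (f := fun a : Fin m → ℝ≥0 => incentiveMeasure P a w)
    ⟨1, by rintro _ ⟨a, rfl⟩; exact incentiveMeasure_le_one P a w⟩ a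

theorem worstIncentiveMeasure_le_one (P : Multiset ℝ≥0 → ℝ≥0) {m k : ℕ}
    (w : Fin k → ℝ≥0) : worstIncentiveMeasure P m w ≤ 1 :=
  ciSup_le fun a => incentiveMeasure_le_one P a w

theorem worstIncentiveMeasure_nonneg (P : Multiset ℝ≥0 → ℝ≥0) {m k : ℕ}
    (w : Fin k → ℝ≥0) : 0 ≤ worstIncentiveMeasure P m w := by
  refine le_trans ?_ (incentiveMeasure_le_worst P (fun _ => 0) w)
  have h := div_le_one_of_le₀ (iInf_price_le P (fun _ : Fin m => 0) w) (NNReal.coe_nonneg _)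
  unfold incentiveMeasure
  linarith

theorem sub_le_mul_worstIncentiveMeasure (P : Multiset ℝ≥0 → ℝ≥0) {m k : ℕ}
    (a b : Fin m → ℝ≥0) (w : Fin k → ℝ≥0) :
    (P (pool a w) : ℝ) - P (pool b w) ≤ P (pool a w) * worstIncentiveMeasure P m w := by
  have h1 := iInf_price_le P b w
  have h2 := incentiveMeasure_le_worst P a w
  -- At price 0 the quotient is a division by zero, but then the left side is nonpositive anyway.
  rcases eq_or_lt_of_le (NNReal.coe_nonneg (P (pool a w))) with h | h
  · rw [← h]
    simp
  · have h3 := mul_le_mul_of_nonneg_left h2 h.le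
    unfold incentiveMeasure at h3
    rw [mul_sub, mul_div_cancel₀ _ h.ne'] at h3
    linarith

theorem card_pool {m k : ℕ} (a : Fin m → ℝ≥0) (w : Fin k → ℝ≥0) :
    (pool a w).card = m + k := by
  simp [pool]

/-- When every sample is manipulable, reporting only zeros drives the price to 0. This is the
convention Δ = 1 for m ≥ N. -/
theorem worstIncentiveMeasure_ERM_empty {c : ℝ} (hc : c < 1) {m : ℕ} (hm : 0 < m)
    (w : Fin 0 → ℝ≥0) : worstIncentiveMeasure (ERM c) m w = 1 := by
  refine le_antisymm (worstIncentiveMeasure_le_one _ w) ?_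
  refine le_trans ?_ (incentiveMeasure_le_worst _ (fun _ => 1) w)
  have h0 : ERM c (pool (fun _ : Fin m => 0) w) = 0 := by
    obtain ⟨i, hi, h, -⟩ := exists_ERM_eq_kthLargest hc
      (s := pool (fun _ : Fin m => 0) w) (by rw [card_pool]; omega)
    rw [h]
    by_contra hne
    have hpos := pos_iff_ne_zero.2 hne
    have h1 := (le_kthLargest_iff hpos _ (mem_guardedIndices.1 hi).1.1).1 le_rfl
    have h2 : ((pool (fun _ : Fin m => 0) w).filter
        (kthLargest (pool (fun _ : Fin m => 0) w) i ≤ ·)) = 0 := by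
      rw [Multiset.filter_eq_nil]
      intro x hx
      have : x = 0 := by
        simp only [pool, Multiset.mem_add, Multiset.mem_map, IsEmpty.exists_iff, or_false] at hx
        obtain ⟨_, -, h⟩ := hx
        exact h.symm
      rw [this]
      exact not_le.2 hpos
    rw [h2] at h1
    have := (mem_guardedIndices.1 hi).1.1
    simp at h1
    omega
  have hinf := iInf_price_le (ERM c) (fun _ : Fin m => 0) w
  rw [h0] at hinf
  have := le_antisymm hinf (iInf_price_nonneg (ERM c) (m := m) w)
  unfold incentiveMeasure
  rw [this]
  simp

/-- Since δ ≤ 1 the integral is finite, so `toReal` loses nothing. Measurability of the supremum δ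
is not needed. -/
theorem ofReal_worstDelta (P : Multiset ℝ≥0 → ℝ≥0) (F : Measure ℝ≥0) [IsProbabilityMeasure F]
    (N m : ℕ) : ENNReal.ofReal (worstDelta P F N m) =
      ∫⁻ w : Fin (N - m) → ℝ≥0, ENNReal.ofReal (worstIncentiveMeasure P m w)
        ∂(Measure.pi fun _ => F) := by
  refine ENNReal.ofReal_toReal (ne_top_of_le_ne_top ENNReal.one_ne_top ?_)
  calc _ ≤ ∫⁻ w : Fin (N - m) → ℝ≥0, 1 ∂(Measure.pi fun _ => F) :=
        lintegral_mono fun w => by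
          rw [← ENNReal.ofReal_one]
          exact ENNReal.ofReal_le_ofReal (worstIncentiveMeasure_le_one P w)
    _ = 1 := by simp

theorem worstDelta_nonneg (P : Multiset ℝ≥0 → ℝ≥0) (F : Measure ℝ≥0) (N m : ℕ) :
    0 ≤ worstDelta P F N m := ENNReal.toReal_nonneg

theorem worstDelta_ERM_of_le {c : ℝ} (hc : c < 1) (F : Measure ℝ≥0) [IsProbabilityMeasure F]
    {N m : ℕ} (hm : 0 < m) (h : N ≤ m) : worstDelta (ERM c) F N m = 1 := by
  unfold worstDelta
  have h0 : N - m = 0 := by omega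
  rw [h0]
  simp [worstIncentiveMeasure_ERM_empty hc hm]

/-! ### Resampling part of the draws -/

theorem map_curry_pi {ι κ α : Type*} [Fintype ι] [Fintype κ] [MeasurableSpace α]
    (F : Measure α) [IsProbabilityMeasure F] :
    (Measure.pi fun _ : ι × κ => F).map (MeasurableEquiv.curry ι κ α) =
      Measure.pi fun _ : ι => Measure.pi fun _ : κ => F := by
  rw [MeasurableEquiv.map_apply_eq_iff_map_symm_apply_eq]
  refine Measure.pi_eq (μ := fun _ : ι × κ => F) fun s hs => ?_
  rw [MeasurableEquiv.map_apply]
  have : (MeasurableEquiv.curry ι κ α).symm ⁻¹' Set.univ.pi s =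
      Set.univ.pi fun i => Set.univ.pi fun j => s (i, j) := by
    ext x
    simp only [Set.mem_preimage, Set.mem_univ_pi, Prod.forall]
    rfl
  rw [this, Measure.pi_pi]
  simp only [Measure.pi_pi]
  rw [Fintype.prod_prod_type]

/-- The preimage of a box is a box: the overwritten old coordinates become free, and the fresh ones
inherit their constraints. -/
theorem map_extend_pi {ι κ α : Type*} [Fintype ι] [Fintype κ] [MeasurableSpace α]
    (F : Measure α) [IsProbabilityMeasure F] (e : κ ↪ ι) :
    ((Measure.pi fun _ : ι => F).prod (Measure.pi fun _ : κ => F)).map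
      (fun p => Function.extend e p.2 p.1) = Measure.pi fun _ : ι => F := by
  classical
  have hm : Measurable fun p : (ι → α) × (κ → α) => Function.extend e p.2 p.1 := by
    refine measurable_pi_lambda _ fun i => ?_
    by_cases hi : ∃ j, e j = i
    · obtain ⟨j, rfl⟩ := hi
      simp only [e.injective.extend_apply]
      fun_prop
    · simp only [Function.extend_apply' _ _ _ hi]
      fun_prop
  refine (Measure.pi_eq fun s hs => ?_).symm
  rw [Measure.map_apply hm (MeasurableSet.univ_pi hs)]
  have : (fun p : (ι → α) × (κ → α) => Function.extend e p.2 p.1) ⁻¹' Set.univ.pi s =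
      (Set.univ.pi fun i => if i ∈ Finset.univ.map e then Set.univ else s i) ×ˢ
        (Set.univ.pi fun j => s (e j)) := by
    ext ⟨x, w⟩
    simp only [Set.mem_preimage, Set.mem_univ_pi, Set.mem_prod]
    constructor
    · intro h
      refine ⟨fun i => ?_, fun j => ?_⟩
      · split_ifs with hi
        · trivial
        · have := h i
          rwa [Function.extend_apply' _ _ _ (by simpa using hi)] at this
      · simpa [e.injective.extend_apply] using h (e j)
    · rintro ⟨h1, h2⟩ i
      by_cases hi : ∃ j, e j = i
      · obtain ⟨j, rfl⟩ := hi
        simpa [e.injective.extend_apply] using h2 j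
      · rw [Function.extend_apply' _ _ _ hi]
        simpa [hi] using h1 i
  rw [this, Measure.prod_prod, Measure.pi_pi, Measure.pi_pi]
  have h1 : ∀ i, F (if i ∈ Finset.univ.map e then Set.univ else s i) =
      if i ∈ Finset.univ.map e then 1 else F (s i) := by
    intro i
    split_ifs <;> simp
  simp_rw [h1]
  rw [Finset.prod_ite, Finset.prod_const_one, one_mul,
    ← Finset.prod_map Finset.univ e (fun i => F (s i)),
    ← Finset.prod_filter_mul_prod_filter_not Finset.univ (· ∈ Finset.univ.map e), mul_comm,
    Finset.filter_univ_mem]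

/-- Replace the values at the positions `e j` by the entries of `w`. -/
def resample {T K k : ℕ} (e : Fin k ↪ Fin T × Fin K) (ω : Draws T K) (w : Fin k → ℝ≥0) :
    Draws T K :=
  (fun r j => Function.extend e w (fun x => ω.1 x.1 x.2) (r, j), ω.2)

theorem resample_of_isEmpty {T K : ℕ} (e : Fin 0 ↪ Fin T × Fin K) (ω : Draws T K)
    (w : Fin 0 → ℝ≥0) : resample e ω w = ω := by
  refine Prod.ext ?_ rfl
  ext r j
  simp only [resample]
  rw [Function.extend_apply']
  rintro ⟨j, -⟩
  exact j.elim0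

theorem measurable_resample {T K k : ℕ} (e : Fin k ↪ Fin T × Fin K) :
    Measurable fun p : Draws T K × (Fin k → ℝ≥0) => resample e p.1 p.2 := by
  refine Measurable.prodMk (measurable_pi_lambda _ fun r => measurable_pi_lambda _ fun j => ?_)
    (measurable_snd.comp measurable_fst)
  by_cases hi : ∃ i, e i = (r, j)
  · obtain ⟨i, hi⟩ := hi
    simp only [← hi, e.injective.extend_apply]
    fun_prop
  · simp only [Function.extend_apply' _ _ _ hi]
    fun_prop

instance isProbabilityMeasure_drawLaw (T K : ℕ) (F : Measure ℝ≥0) [IsProbabilityMeasure F] :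
    IsProbabilityMeasure (drawLaw T K F) := by
  unfold drawLaw; infer_instance

/-- Currying reduces tables to families indexed by pairs, where `map_extend_pi` applies; the seeds
are left alone. -/
theorem map_resample {T K k : ℕ} (F : Measure ℝ≥0) [IsProbabilityMeasure F]
    (e : Fin k ↪ Fin T × Fin K) :
    ((drawLaw T K F).prod (Measure.pi fun _ : Fin k => F)).map
      (fun p => resample e p.1 p.2) = drawLaw T K F := by
  set X : Measure (Table T K) := Measure.pi fun _ : Fin T => Measure.pi fun _ : Fin K => F
  set W : Measure (Fin k → ℝ≥0) := Measure.pi fun _ : Fin k => F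
  set E : Table T K × (Fin k → ℝ≥0) → Table T K := fun p r j =>
    Function.extend e p.2 (fun x => p.1 x.1 x.2) (r, j) with hE
  have hEm : Measurable E := by
    have : E = fun p => (resample e (p.1, fun _ => 0) p.2).1 := rfl
    rw [this]
    exact measurable_fst.comp ((measurable_resample e).comp
      ((measurable_fst.prodMk measurable_const).prodMk measurable_snd))
  have hX : (X.prod W).map E = X := by
    have h1 : E = (MeasurableEquiv.curry (Fin T) (Fin K) ℝ≥0) ∘
        (fun p : (Fin T × Fin K → ℝ≥0) × (Fin k → ℝ≥0) => Function.extend e p.2 p.1) ∘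
        Prod.map (MeasurableEquiv.curry (Fin T) (Fin K) ℝ≥0).symm id := rfl
    have hm : Measurable fun p : (Fin T × Fin K → ℝ≥0) × (Fin k → ℝ≥0) =>
        Function.extend e p.2 p.1 := by
      have : (fun p : (Fin T × Fin K → ℝ≥0) × (Fin k → ℝ≥0) => Function.extend e p.2 p.1) =
          (MeasurableEquiv.curry (Fin T) (Fin K) ℝ≥0).symm ∘ E ∘
          Prod.map (MeasurableEquiv.curry (Fin T) (Fin K) ℝ≥0) id := rfl
      rw [this]
      exact (MeasurableEquiv.measurable _).comp
        (hEm.comp ((MeasurableEquiv.measurable _).prodMap measurable_id))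
    rw [h1, ← Measure.map_map (MeasurableEquiv.measurable _)
      (hm.comp ((MeasurableEquiv.measurable _).prodMap measurable_id)),
      ← Measure.map_map hm ((MeasurableEquiv.measurable _).prodMap measurable_id),
      ← Measure.map_prod_map _ _ (MeasurableEquiv.measurable _) measurable_id, Measure.map_id]
    have h2 : X.map (MeasurableEquiv.curry (Fin T) (Fin K) ℝ≥0).symm =
        Measure.pi fun _ : Fin T × Fin K => F :=
      ((MeasurableEquiv.map_apply_eq_iff_map_symm_apply_eq _).1 (map_curry_pi F)).symm
    rw [h2, map_extend_pi, map_curry_pi]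
  unfold drawLaw
  symm
  refine Measure.prod_eq fun s t hs ht => ?_
  have hm := measurable_resample e
  rw [Measure.map_apply hm (hs.prod ht), Measure.prod_apply_symm (hm (hs.prod ht))]
  have h3 : ∀ w : Fin k → ℝ≥0, (fun ω : Draws T K => (ω, w)) ⁻¹'
      ((fun p : Draws T K × (Fin k → ℝ≥0) => resample e p.1 p.2) ⁻¹' s ×ˢ t) =
      ((fun x => (x, w)) ⁻¹' (E ⁻¹' s)) ×ˢ t := fun w => rfl
  simp_rw [h3, Measure.prod_prod]
  rw [lintegral_mul_const _ (measurable_measure_prodMk_right (hEm hs)),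
    ← Measure.prod_apply_symm (hEm hs), ← Measure.map_apply hEm hs, hX]

/-- Conditioning on a statistic that is invariant under a measure preserving resampling leaves the
resampling measure preserving. -/
theorem ae_condDistrib_id_eq_map_prod {Ω W H : Type*} [MeasurableSpace Ω] [StandardBorelSpace Ω]
    [Nonempty Ω] [MeasurableSpace W] [MeasurableSpace H] {μ : Measure Ω} [IsProbabilityMeasure μ]
    {ρ : Measure W} [IsProbabilityMeasure ρ] {φ : Ω × W → Ω} (hφ : Measurable φ)
    (hmap : (μ.prod ρ).map φ = μ) {X : Ω → H} (hX : Measurable X)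
    (hinv : ∀ p, X (φ p) = X p.1) :
    ∀ᵐ h ∂(μ.map X), condDistrib id X μ h = ((condDistrib id X μ h).prod ρ).map φ := by
  -- Conditional distributions are a.e. unique, so it suffices that the resampled kernel also
  -- disintegrates the joint law of `X` and the draw.
  have key := condDistrib_ae_eq_of_measure_eq_compProd_of_measurable hX
    (measurable_id (α := Ω)) (μ := μ)
    (κ := ((condDistrib id X μ) ×ₖ Kernel.const H ρ).map φ) ?_
  · filter_upwards [key] with h hh
    conv_lhs => rw [hh]
    rw [Kernel.map_apply _ hφ, Kernel.prod_apply, Kernel.const_apply]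
  · refine Measure.ext_of_lintegral _ fun g hg => ?_
    have hXid : Measurable fun x => (X x, id x) := hX.prodMk measurable_id
    have hin : Measurable fun q : H × Ω => ∫⁻ w, g (q.1, φ (q.2, w)) ∂ρ :=
      Measurable.lintegral_prod_right (f := fun (q : H × Ω) w => g (q.1, φ (q.2, w)))
        (hg.comp (Measurable.prodMk (by fun_prop) (by fun_prop)))
    rw [Measure.lintegral_compProd hg]
    have h1 : ∀ h, ∫⁻ b, g (h, b) ∂(((condDistrib id X μ) ×ₖ Kernel.const H ρ).map φ h) =
        ∫⁻ ω, ∫⁻ w, g (h, φ (ω, w)) ∂ρ ∂(condDistrib id X μ h) := by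
      intro h
      have hgh : Measurable fun b => g (h, b) := hg.comp measurable_prodMk_left
      rw [Kernel.map_apply _ hφ, lintegral_map hgh hφ, Kernel.prod_apply, Kernel.const_apply,
        lintegral_prod (fun p => g (h, φ p)) (hgh.comp hφ).aemeasurable]
    simp_rw [h1]
    rw [← Measure.lintegral_compProd (f := fun q : H × Ω => ∫⁻ w, g (q.1, φ (q.2, w)) ∂ρ) hin,
      compProd_map_condDistrib (measurable_id.aemeasurable), lintegral_map hin hXid,
      lintegral_map hg hXid]
    have hg2 : Measurable fun p => g (X (φ p), φ p) :=
      hg.comp ((hX.comp hφ).prodMk hφ)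
    -- Invariance moves `φ` into both components, after which it acts on the whole integrand and
    -- `hmap` removes it.
    have h2 : ∀ ω, ∫⁻ w, g (X ω, φ (ω, w)) ∂ρ = ∫⁻ w, g (X (φ (ω, w)), φ (ω, w)) ∂ρ := by
      intro ω
      simp_rw [hinv]
    simp only [id]
    simp_rw [h2]
    rw [← lintegral_prod (fun p => g (X (φ p), φ p)) hg2.aemeasurable,
      ← lintegral_map (f := fun x => g (X x, x)) (hg.comp hXid) hφ, hmap]

/-! ### Expectations in the extended reals -/

/-- Positive and negative parts are kept on opposite sides of the inequality, so that nothing is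
subtracted until all four integrals are known to be finite. -/
theorem extExpectation_sub_le {Ω : Type*} [MeasurableSpace Ω] {μ : Measure Ω} {f f' : Ω → ℝ}
    (hf : Measurable f) (hf' : Measurable f') {ε : ℝ} (hε : 0 ≤ ε)
    (h : ∫⁻ ω, ENNReal.ofReal (f' ω - f ω) ∂μ ≤ ENNReal.ofReal ε) :
    extExpectation μ f' - (ε : EReal) ≤ extExpectation μ f := by
  unfold extExpectation
  have hneg : ∀ {u v : Ω → ℝ}, (∀ ω, ENNReal.ofReal (u ω) ≤ ENNReal.ofReal (v ω) +
      ENNReal.ofReal (f' ω - f ω)) → Measurable v →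
      ∫⁻ ω, ENNReal.ofReal (u ω) ∂μ ≤ ∫⁻ ω, ENNReal.ofReal (v ω) ∂μ + ENNReal.ofReal ε := by
    intro u v huv hv
    calc _ ≤ ∫⁻ ω, ENNReal.ofReal (v ω) + ENNReal.ofReal (f' ω - f ω) ∂μ := lintegral_mono huv
      _ = ∫⁻ ω, ENNReal.ofReal (v ω) ∂μ + ∫⁻ ω, ENNReal.ofReal (f' ω - f ω) ∂μ :=
        lintegral_add_left (by fun_prop) _
      _ ≤ _ := by gcongr
  have hadd : ∀ {x y z : ℝ}, x ≤ y + z →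
      ENNReal.ofReal x ≤ ENNReal.ofReal y + ENNReal.ofReal z := fun hxyz =>
    (ENNReal.ofReal_le_ofReal hxyz).trans ENNReal.ofReal_add_le
  have h1 := hneg (u := f') (v := f) (fun ω => hadd (by linarith)) hf
  have h2 := hneg (u := fun ω => -f ω) (v := fun ω => -f' ω) (fun ω => hadd (by linarith)) hf'.neg
  have h3 : ∫⁻ ω, ENNReal.ofReal (f' ω) ∂μ + ∫⁻ ω, ENNReal.ofReal (-f ω) ∂μ ≤
      ∫⁻ ω, ENNReal.ofReal (f ω) ∂μ + ∫⁻ ω, ENNReal.ofReal (-f' ω) ∂μ + ENNReal.ofReal ε := by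
    rw [← lintegral_add_left (by fun_prop), ← lintegral_add_left (by fun_prop)]
    refine le_trans ?_ (add_le_add_right h _)
    rw [← lintegral_add_left (by fun_prop)]
    refine lintegral_mono fun ω => ?_
    rcases le_total 0 (f ω) with h0 | h0 <;> rcases le_total 0 (f' ω) with h0' | h0'
    · rw [ENNReal.ofReal_of_nonpos (neg_nonpos.2 h0), ENNReal.ofReal_of_nonpos (neg_nonpos.2 h0')]
      simpa using hadd (by linarith)
    · rw [ENNReal.ofReal_of_nonpos (neg_nonpos.2 h0), ENNReal.ofReal_of_nonpos h0']
      simp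
    · rw [ENNReal.ofReal_of_nonpos h0, ENNReal.ofReal_of_nonpos (neg_nonpos.2 h0'), zero_add,
        zero_add, ← ENNReal.ofReal_add h0' (neg_nonneg.2 h0), sub_eq_add_neg]
    · rw [ENNReal.ofReal_of_nonpos h0, ENNReal.ofReal_of_nonpos h0', zero_add, zero_add]
      exact hadd (by linarith)
  generalize ∫⁻ ω, ENNReal.ofReal (f ω) ∂μ = a at *
  generalize ∫⁻ ω, ENNReal.ofReal (-f ω) ∂μ = b at *
  generalize ∫⁻ ω, ENNReal.ofReal (f' ω) ∂μ = a' at *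
  generalize ∫⁻ ω, ENNReal.ofReal (-f' ω) ∂μ = b' at *
  -- Here the deviation has expected utility ⊥, and there is nothing to prove.
  by_cases hb' : b' = ⊤
  · subst hb'
    simp
  have hb : b ≠ ⊤ := ne_top_of_le_ne_top (by finiteness) h2
  by_cases ha : a = ⊤
  · subst ha
    lift b to ℝ≥0 using hb
    simp
  have ha' : a' ≠ ⊤ := ne_top_of_le_ne_top (by finiteness) h1
  lift a to ℝ≥0 using ha
  lift b to ℝ≥0 using hb
  lift a' to ℝ≥0 using ha'
  lift b' to ℝ≥0 using hb'
  lift ε to ℝ≥0 using hε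
  rw [ENNReal.ofReal_coe_nnreal] at h3
  norm_cast at h3
  have h4 : (a' : ℝ) + b ≤ a + b' + ε := by exact_mod_cast h3
  have h5 : (a' : ℝ) - b' - ε ≤ a - b := by linarith
  simp only [EReal.coe_nnreal_eq_coe_real]
  exact_mod_cast h5

/-! ### Measurability of play -/

/-- The outcome of each round depends measurably on the bids of the earlier rounds, the bids of the
round, and the seed. -/
structure MeasurableMechanism {T K : ℕ} (G : Mechanism T K) : Prop where
  winner : ∀ r k, MeasurableSet {x : (Table T K × (Fin K → ℝ≥0)) × unitInterval |
    (G r x.1.1).winner x.1.2 x.2 = some k}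
  pay : ∀ r k, Measurable fun x : (Table T K × (Fin K → ℝ≥0)) × unitInterval =>
    (G r x.1.1).pay x.1.2 x.2 k
  info : ∀ r k, Measurable fun x : (Table T K × (Fin K → ℝ≥0)) × unitInterval =>
    (G r x.1.1).info x.1.2 x.2 k

theorem measurable_before {T K : ℕ} (t : ℕ) : Measurable (before (T := T) (K := K) t) := by
  refine measurable_pi_lambda _ fun r => measurable_pi_lambda _ fun k => ?_
  unfold before
  split_ifs <;> fun_prop

section

variable {n T K : ℕ} (S : Schedule n T K) {G : Mechanism T K} {Ω : Type*} [MeasurableSpace Ω]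

theorem measurable_history (hG : MeasurableMechanism G) {b : Ω → Table T K}
    {s : Ω → Fin T → unitInterval} (hb : Measurable b) (hs : Measurable s) (t : ℕ) (i : Fin n) :
    Measurable fun ω => S.history G (b ω) (s ω) t i := by
  classical
  refine measurable_pi_lambda _ fun r => measurable_pi_lambda _ fun k => ?_
  unfold Schedule.history
  by_cases h : (r : ℕ) < t ∧ S.bidder r k = i
  · simp only [h, and_self, if_true]
    have hbr : Measurable fun ω => b ω r := (measurable_pi_apply r).comp hb
    have harg : Measurable fun ω => ((before (r : ℕ) (b ω), b ω r), s ω r) :=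
      (((measurable_before _).comp hb).prodMk hbr).prodMk ((measurable_pi_apply r).comp hs)
    refine ((measurable_pi_apply k).comp hbr).prodMk (Measurable.prodMk ?_ (Measurable.prodMk
      ((hG.pay r k).comp harg) ((hG.info r k).comp harg)))
    have : (fun ω => decide ((G r (before (r : ℕ) (b ω))).winner (b ω r) (s ω r) = some k)) =
        fun ω => if (G r (before (r : ℕ) (b ω))).winner (b ω r) (s ω r) = some k
          then true else false := by
      ext ω
      simp
    rw [this]
    exact Measurable.ite (harg (hG.winner r k)) measurable_const measurable_const
  · simp only [h, if_false]
    exact measurable_const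

theorem measurable_values {x : Ω → Table T K} (hx : Measurable x) (i : Fin n) :
    Measurable fun ω => S.values (x ω) i := by
  refine measurable_pi_lambda _ fun r => ?_
  unfold Schedule.values
  refine Finset.measurable_sum _ fun k _ => ?_
  split_ifs <;> fun_prop

theorem measurable_withValues (i : Fin n) (v : Fin T → ℝ≥0) :
    Measurable (S.withValues i v) := by
  refine measurable_pi_lambda _ fun r => measurable_pi_lambda _ fun k => ?_
  unfold Schedule.withValues
  split_ifs <;> fun_prop

theorem measurable_play (hG : MeasurableMechanism G) (σ : Fin n → Strategy T K)
    {x : Ω → Table T K} {s : Ω → Fin T → unitInterval} (hx : Measurable x) (hs : Measurable s) :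
    ∀ t, Measurable fun ω => S.play G σ (x ω) (s ω) t
  | 0 => measurable_const
  | t + 1 => by
    have ih := measurable_play hG σ hx hs t
    refine measurable_pi_lambda _ fun r => measurable_pi_lambda _ fun k => ?_
    unfold Schedule.play
    by_cases h : (r : ℕ) = t
    · simp only [h, if_true]
      exact ((σ (S.bidder r k)).measurable_bid r).comp
        ((measurable_values S hx _).prodMk (measurable_history S hG ih hs t _))
    · simp only [h, if_false]
      fun_prop

theorem measurable_utilityFrom (hG : MeasurableMechanism G) {x b : Ω → Table T K}
    (hx : Measurable x) (hb : Measurable b) (t : Fin T) (i : Fin n) :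
    Measurable fun ω => S.utilityFrom G (x ω) (b ω) t i := by
  unfold Schedule.utilityFrom
  refine Finset.measurable_sum _ fun r _ => Finset.measurable_sum _ fun k _ => ?_
  split_ifs with h
  · have hbr : Measurable fun ω => b ω r := (measurable_pi_apply r).comp hb
    have harg : Measurable fun p : Ω × unitInterval =>
        ((before (r : ℕ) (b p.1), b p.1 r), p.2) :=
      ((((measurable_before _).comp hb).prodMk hbr).comp measurable_fst).prodMk measurable_snd
    have hu : Measurable fun p : Ω × unitInterval =>
        (if (G r (before (r : ℕ) (b p.1))).winner (b p.1 r) p.2 = some k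
          then ((x p.1 r k : ℝ≥0) : ℝ) else 0) -
          (G r (before (r : ℕ) (b p.1))).pay (b p.1 r) p.2 k := by
      refine Measurable.sub (Measurable.ite (harg (hG.winner r k)) ?_ measurable_const)
        ((hG.pay r k).comp harg)
      fun_prop
    exact (hu.stronglyMeasurable.integral_prod_right (ν := (volume : Measure unitInterval))).measurable
  · exact measurable_const

/-- The utility of bidder `i` from round `t` on, when she plays `ρ` before round `t` and `σ`
afterwards and the others are truthful. -/
def Schedule.switchUtility (S : Schedule n T K) (G : Mechanism T K) (i : Fin n)
    (v : Fin T → ℝ≥0) (t : Fin T) (ρ σ : Strategy T K) (ω : Draws T K) : ℝ :=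
  S.utilityFrom G (S.withValues i v ω.1)
    (S.play G (Function.update (fun _ => truthful T K) i (ρ.switch t σ))
      (S.withValues i v ω.1) ω.2 T) t i

theorem measurable_switchUtility (hG : MeasurableMechanism G) (i : Fin n)
    (v : Fin T → ℝ≥0) (t : Fin T) (ρ σ : Strategy T K) :
    Measurable (S.switchUtility G i v t ρ σ) := by
  have hx : Measurable fun ω : Draws T K => S.withValues i v ω.1 :=
    (measurable_withValues S i v).comp measurable_fst
  exact measurable_utilityFrom S hG hx (measurable_play S hG _ hx measurable_snd T) t i

/-- Truthful bidding is an equilibrium if the gain from deviating is small on average when draws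
about which the history is not informative are resampled. -/
theorem isPBIC_of_lintegral_resample_le (hG : MeasurableMechanism G) {F : Measure ℝ≥0}
    [IsProbabilityMeasure F] {V : Set ℝ≥0} {ε : ℝ} (hε : 0 ≤ ε)
    (h : ∀ (i : Fin n) (t : Fin T) (v : Fin T → ℝ≥0), (∀ r, v r ∈ V) → ∀ ρ : Strategy T K,
      ∃ (k : ℕ) (e : Fin k ↪ Fin T × Fin K),
        (∀ ω w, S.randomHistory G (Function.update (fun _ => truthful T K) i ρ) i v t
            (resample e ω w) =
          S.randomHistory G (Function.update (fun _ => truthful T K) i ρ) i v t ω) ∧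
        ∀ σ ω, ∫⁻ w, ENNReal.ofReal (S.switchUtility G i v t ρ σ (resample e ω w) -
          S.switchUtility G i v t ρ (truthful T K) (resample e ω w))
            ∂(Measure.pi fun _ : Fin k => F) ≤ ENNReal.ofReal ε) :
    S.IsPBIC G F V ε := by
  intro i t v hv ρ
  obtain ⟨k, e, hinv, hgain⟩ := h i t v hv ρ
  have hX : Measurable (S.randomHistory G (Function.update (fun _ => truthful T K) i ρ) i v t) := by
    have hx : Measurable fun ω : Draws T K => S.withValues i v ω.1 :=
      (measurable_withValues S i v).comp measurable_fst
    exact measurable_history S hG (measurable_play S hG _ hx measurable_snd t)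
      measurable_snd t i
  -- The exceptional null set comes from the belief alone, so one set serves all deviations `σ`.
  filter_upwards [ae_condDistrib_id_eq_map_prod (measurable_resample e) (map_resample F e) hX
    fun p => hinv p.1 p.2] with h hh σ
  have hm := measurable_switchUtility S hG i v t ρ σ
  have hm' := measurable_switchUtility S hG i v t ρ (truthful T K)
  refine extExpectation_sub_le hm' hm hε ?_
  have hsub : Measurable fun ω => ENNReal.ofReal (S.switchUtility G i v t ρ σ ω -
    S.switchUtility G i v t ρ (truthful T K) ω) := (hm.sub hm').ennreal_ofReal
  unfold Schedule.belief
  rw [hh, lintegral_map hsub (measurable_resample e)]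
  have hcomp : Measurable fun p : Draws T K × (Fin k → ℝ≥0) =>
      ENNReal.ofReal (S.switchUtility G i v t ρ σ (resample e p.1 p.2) -
        S.switchUtility G i v t ρ (truthful T K) (resample e p.1 p.2)) :=
    hsub.comp (measurable_resample e)
  rw [lintegral_prod _ hcomp.aemeasurable]
  calc _ ≤ ∫⁻ ω, ENNReal.ofReal ε ∂(condDistrib id (S.randomHistory G
        (Function.update (fun _ => truthful T K) i ρ) i v t) (drawLaw T K F) h) :=
        lintegral_mono fun ω => hgain σ ω
    _ = ENNReal.ofReal ε := by simp

end

/-! ### The two-phase algorithm: incentives -/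

theorem secondPrice_payoff {K : ℕ} (τ : TieBreaking K) (p v : ℝ≥0) (b : Fin K → ℝ≥0)
    (s : unitInterval) (k : Fin K) :
    (if (secondPrice τ p).winner b s = some k then (v : ℝ) else 0) - (secondPrice τ p).pay b s k =
      if p ≤ b k ∧ k = τ.top b s
        then (v : ℝ) - ((max p ((Finset.univ.erase k).sup b) : ℝ≥0) : ℝ) else 0 := by
  by_cases h2 : k = τ.top b s
  · subst h2
    by_cases h1 : p ≤ b (τ.top b s) <;> simp [secondPrice, h1]
  · by_cases h1 : p ≤ b (τ.top b s) <;> simp [secondPrice, h1, h2, Ne.symm h2]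

/-- A winner pays the maximum of the reserve and the other bids, whatever her own bid. -/
theorem secondPrice_utility_le {K : ℕ} (τ : TieBreaking K) (p v : ℝ≥0) (b : Fin K → ℝ≥0)
    (k : Fin K) : (secondPrice τ p).utility v b k ≤
      max 0 ((v : ℝ) - ((max p ((Finset.univ.erase k).sup b) : ℝ≥0) : ℝ)) := by
  unfold Auction.utility
  simp_rw [secondPrice_payoff]
  set u : unitInterval → ℝ := fun s => if p ≤ b k ∧ k = τ.top b s
        then (v : ℝ) - ((max p ((Finset.univ.erase k).sup b) : ℝ≥0) : ℝ) else 0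
  have hu : ∀ s, u s ≤ max 0 ((v : ℝ) - ((max p ((Finset.univ.erase k).sup b) : ℝ≥0) : ℝ)) := by
    intro s
    simp only [u]
    split_ifs
    · exact le_max_right _ _
    · exact le_max_left _ _
  by_cases hi : Integrable u
  · calc ∫ s, u s ≤ ∫ s : unitInterval,
          max 0 ((v : ℝ) - ((max p ((Finset.univ.erase k).sup b) : ℝ≥0) : ℝ)) :=
        integral_mono hi (integrable_const _) hu
      _ = _ := by rw [integral_const, probReal_univ, one_smul]
  · rw [integral_undef hi]
    exact le_max_left _ _

/-- Bidding the value attains the upper bound of `secondPrice_utility_le`, with any tie-breaking: a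
tied loser would have paid her full value. -/
theorem secondPrice_utility_update {K : ℕ} (τ : TieBreaking K) (p v : ℝ≥0) (b : Fin K → ℝ≥0)
    (k : Fin K) : (secondPrice τ p).utility v (Function.update b k v) k =
      max 0 ((v : ℝ) - ((max p ((Finset.univ.erase k).sup b) : ℝ≥0) : ℝ)) := by
  unfold Auction.utility
  have hsup : (Finset.univ.erase k).sup (Function.update b k v) = (Finset.univ.erase k).sup b :=
    Finset.sup_congr rfl fun j hj => Function.update_of_ne (Finset.ne_of_mem_erase hj) _ _
  simp_rw [secondPrice_payoff, hsup, Function.update_self]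
  have hu : ∀ s, (if p ≤ v ∧ k = τ.top (Function.update b k v) s
      then (v : ℝ) - ((max p ((Finset.univ.erase k).sup b) : ℝ≥0) : ℝ) else 0) =
      max 0 ((v : ℝ) - ((max p ((Finset.univ.erase k).sup b) : ℝ≥0) : ℝ)) := by
    intro s
    have htop := τ.le_top (Function.update b k v) s
    by_cases h2 : k = τ.top (Function.update b k v) s
    · rw [← h2, Function.update_self] at htop
      have hle : (Finset.univ.erase k).sup b ≤ v := by
        refine Finset.sup_le fun j hj => ?_
        have := htop j
        rwa [Function.update_of_ne (Finset.ne_of_mem_erase hj)] at this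
      by_cases h1 : p ≤ v
      · rw [if_pos ⟨h1, h2⟩]
        exact (max_eq_right (sub_nonneg.2 (NNReal.coe_le_coe.2 (max_le h1 hle)))).symm
      · rw [if_neg fun h => h1 h.1, max_eq_left]
        exact sub_nonpos.2 (NNReal.coe_le_coe.2 (le_max_of_le_left (not_le.1 h1).le))
    · have h4 := htop k
      rw [Function.update_self, Function.update_of_ne (Ne.symm h2)] at h4
      rw [if_neg fun h => h2 h.2, max_eq_left]
      exact sub_nonpos.2 (NNReal.coe_le_coe.2 (le_max_of_le_right (h4.trans (Finset.le_sup
          (f := b) (Finset.mem_erase.2 ⟨Ne.symm h2, Finset.mem_univ _⟩)))))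
  simp_rw [hu]
  rw [integral_const, probReal_univ, one_smul]

/-- The minimum appears because a reserve `p` above the value excludes the bidder just as a reserve
equal to her value leaves her no surplus; lowering it helps only below the value. -/
theorem secondPrice_utility_sub_le {K : ℕ} (τ : TieBreaking K) (p p' v : ℝ≥0) (b : Fin K → ℝ≥0)
    (k : Fin K) {B : ℝ} (hB : 0 ≤ B) (h : min (v : ℝ) p - p' ≤ B) :
    (secondPrice τ p').utility v b k - (secondPrice τ p).utility v (Function.update b k v) k
      ≤ B := by
  have h1 := secondPrice_utility_le τ p' v b k
  rw [secondPrice_utility_update]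
  push_cast at h1 ⊢
  refine (sub_le_sub_right h1 _).trans ?_
  grind

theorem measurableMechanism_twoPhaseERM {T K : ℕ} {M : Auction K} (hM : M.Regular)
    (τ : TieBreaking K) (T₁ : ℕ) (c : ℝ) :
    MeasurableMechanism (T := T) (twoPhaseERM M τ T₁ c) := by
  have hp : Measurable fun b : Table T K => ERM c (firstPhaseBids T₁ b) :=
    (measurable_ERM ((Finset.univ.filter fun r : Fin T => (r : ℕ) < T₁) ×ˢ
      (Finset.univ : Finset (Fin K))) c).comp
      (f := fun (b : Table T K) (x : Fin T × Fin K) => b x.1 x.2) (by fun_prop)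
  have hp' : Measurable fun x : (Table T K × (Fin K → ℝ≥0)) × unitInterval =>
      ERM c (firstPhaseBids T₁ x.1.1) := hp.comp (by fun_prop)
  have htop : Measurable fun x : (Table T K × (Fin K → ℝ≥0)) × unitInterval =>
      τ.top x.1.2 x.2 := τ.measurable_top.comp (f := fun x : (Table T K × (Fin K → ℝ≥0)) ×
        unitInterval => (x.1.2, x.2)) (by fun_prop)
  have htopb : Measurable fun x : (Table T K × (Fin K → ℝ≥0)) × unitInterval =>
      x.1.2 (τ.top x.1.2 x.2) := by
    have : (fun x : (Table T K × (Fin K → ℝ≥0)) × unitInterval => x.1.2 (τ.top x.1.2 x.2)) =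
        fun x => ∑ k, if τ.top x.1.2 x.2 = k then x.1.2 k else 0 := by
      ext x; simp
    rw [this]
    exact Finset.measurable_sum _ fun k _ => Measurable.ite
      (htop (measurableSet_singleton k)) (by fun_prop) measurable_const
  have hres := measurableSet_le hp' htopb
  have hproj : Measurable fun x : (Table T K × (Fin K → ℝ≥0)) × unitInterval => (x.1.2, x.2) := by
    fun_prop
  constructor
  · intro r k
    unfold twoPhaseERM
    split_ifs
    · exact hproj (hM.measurable_winner k)
    · have : {x : (Table T K × (Fin K → ℝ≥0)) × unitInterval |
          (secondPrice τ (ERM c (firstPhaseBids T₁ x.1.1))).winner x.1.2 x.2 = some k} =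
          {x | ERM c (firstPhaseBids T₁ x.1.1) ≤ x.1.2 (τ.top x.1.2 x.2)} ∩
          {x | τ.top x.1.2 x.2 = k} := by
        ext x
        simp [secondPrice]
      rw [this]
      exact hres.inter (htop (measurableSet_singleton k))
  · intro r k
    unfold twoPhaseERM
    split_ifs
    · exact (hM.measurable_pay k).comp hproj
    · unfold secondPrice
      refine Measurable.ite (hres.inter ?_) ?_ measurable_const
      · exact measurableSet_eq_fun measurable_const htop
      · have hsup : Measurable fun x : (Table T K × (Fin K → ℝ≥0)) × unitInterval =>
            (Finset.univ.erase k).sup x.1.2 := by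
          have hcont : Measurable fun b : Fin K → ℝ≥0 => (Finset.univ.erase k).sup b := by
            refine measurable_of_Iic fun y => ?_
            have : (fun b : Fin K → ℝ≥0 => (Finset.univ.erase k).sup b) ⁻¹' Set.Iic y =
                ⋂ j ∈ Finset.univ.erase k, {b | b j ≤ y} := by
              ext b
              simp only [Set.mem_preimage, Set.mem_Iic, Finset.sup_le_iff, Set.mem_iInter,
                Set.mem_ofPred_eq]
            rw [this]
            exact Finset.measurableSet_biInter _ fun j _ =>
              measurableSet_le (measurable_pi_apply j) measurable_const
          exact hcont.comp (by fun_prop)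
        exact (hp'.max hsup).coe_nnreal_real
  · intro r k
    unfold twoPhaseERM
    split_ifs
    · exact (hM.measurable_info k).comp hproj
    · exact hp'.coe_nnreal_real

/-! ### How bids, reserve prices and histories react to the strategy of one bidder -/

section

variable {n T K : ℕ} (S : Schedule n T K) (G : Mechanism T K)

theorem play_eq_ite (σ : Fin n → Strategy T K) (x : Table T K) (s : Fin T → unitInterval)
    (r : Fin T) (k : Fin K) : ∀ t : ℕ, S.play G σ x s t r k =
      if (r : ℕ) < t then (σ (S.bidder r k)).bid r (S.values x (S.bidder r k))
        (S.history G (S.play G σ x s r) s r (S.bidder r k)) else 0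
  | 0 => by simp [Schedule.play]
  | t + 1 => by
    have ih := play_eq_ite σ x s r k t
    rw [Schedule.play]
    dsimp only
    by_cases h : (r : ℕ) = t
    · rw [if_pos h, if_pos (by omega)]
      subst h
      rfl
    · rw [if_neg h, ih]
      have : (r : ℕ) < t ↔ (r : ℕ) < t + 1 := by omega
      simp only [this]

theorem values_apply (x : Table T K) (r : Fin T) (k : Fin K) :
    S.values x (S.bidder r k) r = x r k := by
  unfold Schedule.values
  rw [Finset.sum_eq_single k]
  · simp
  · intro j _ hj
    rw [if_neg fun h => hj (S.injective r h)]
  · simp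

theorem values_withValues (x x' : Table T K) (i : Fin n) (v : Fin T → ℝ≥0) :
    S.values (S.withValues i v x) i = S.values (S.withValues i v x') i := by
  ext r
  unfold Schedule.values Schedule.withValues
  congr 1
  refine Finset.sum_congr rfl fun k _ => ?_
  split_ifs <;> rfl

/-- Truthful opponents do not react, so their bids are the same under every strategy of bidder `i`.
-/
theorem play_of_bidder_ne {i : Fin n} (ρ : Strategy T K) (x : Table T K)
    (s : Fin T → unitInterval) {r : Fin T} {k : Fin K} (h : S.bidder r k ≠ i) {t : ℕ}
    (ht : (r : ℕ) < t) :
    S.play G (Function.update (fun _ => truthful T K) i ρ) x s t r k = x r k := by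
  rw [play_eq_ite, if_pos ht, Function.update_of_ne h]
  exact values_apply S x r k

theorem play_switch {i : Fin n} (ρ σ σ' : Strategy T K) (x : Table T K)
    (s : Fin T → unitInterval) (t : Fin T) : ∀ u : ℕ, u ≤ t →
    S.play G (Function.update (fun _ => truthful T K) i (ρ.switch t σ)) x s u =
      S.play G (Function.update (fun _ => truthful T K) i (ρ.switch t σ')) x s u
  | 0, _ => rfl
  | u + 1, hu => by
    have ih := play_switch (i := i) ρ σ σ' x s t u (by omega)
    ext r k
    unfold Schedule.play
    rw [ih]
    split_ifs with h
    · by_cases hi : S.bidder r k = i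
      · have hr : r < t := by
          rw [Fin.lt_def]; omega
        rw [hi, Function.update_self, Function.update_self]
        simp [Strategy.switch, hr]
      · rw [Function.update_of_ne hi, Function.update_of_ne hi]
    · rfl

theorem firstPhaseBids_congr {T₁ : ℕ} {b b' : Table T K}
    (h : ∀ (r : Fin T) (k : Fin K), (r : ℕ) < T₁ → b r k = b' r k) :
    firstPhaseBids T₁ b = firstPhaseBids T₁ b' := by
  unfold firstPhaseBids
  refine Multiset.map_congr rfl fun x hx => h _ _ ?_
  have hx' : x ∈ (Finset.univ.filter fun r : Fin T => (r : ℕ) < T₁) ×ˢ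
    (Finset.univ : Finset (Fin K)) := hx
  simpa using hx'

/-- The two continuations are compared round by round on the same draws. In each round from `t` on,
the bid vectors differ only in the entry of bidder `i`, so a first-phase round gains nothing by
truthfulness of `M`, and a later round gains only through the reserve. -/
theorem switchUtility_sub_le {M : Auction K} (hM : M.Truthful) (τ : TieBreaking K) (T₁ : ℕ)
    (c : ℝ) (i : Fin n) (v : Fin T → ℝ≥0) (t : Fin T) (ρ σ : Strategy T K) (ω : Draws T K)
    {B : ℝ} (hB : 0 ≤ B)
    (h : ∀ r, min (v r : ℝ) (ERM c (firstPhaseBids T₁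
        (S.play (twoPhaseERM M τ T₁ c) (Function.update (fun _ => truthful T K) i
          (ρ.switch t (truthful T K))) (S.withValues i v ω.1) ω.2 T))) -
      ERM c (firstPhaseBids T₁
        (S.play (twoPhaseERM M τ T₁ c) (Function.update (fun _ => truthful T K) i
          (ρ.switch t σ)) (S.withValues i v ω.1) ω.2 T)) ≤ B) :
    S.switchUtility (twoPhaseERM M τ T₁ c) i v t ρ σ ω -
      S.switchUtility (twoPhaseERM M τ T₁ c) i v t ρ (truthful T K) ω ≤
        (S.rounds i).card * B := by
  unfold Schedule.switchUtility Schedule.utilityFrom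
  set x := S.withValues i v ω.1 with hx
  set b := S.play (twoPhaseERM M τ T₁ c) (Function.update (fun _ => truthful T K) i
          (ρ.switch t (truthful T K))) x ω.2 T with hb
  set b' := S.play (twoPhaseERM M τ T₁ c) (Function.update (fun _ => truthful T K) i
          (ρ.switch t σ)) x ω.2 T with hb'
  -- Cutting off at a second-phase round keeps every first-phase bid.
  have hfirst : ∀ (b : Table T K) (r : Fin T), T₁ ≤ (r : ℕ) →
      firstPhaseBids T₁ (before r b) = firstPhaseBids T₁ b := fun b r hr =>
    firstPhaseBids_congr fun r' k hr' => by
      unfold before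
      rw [if_pos (by omega)]
  have hterm : ∀ (r : Fin T) (k : Fin K), t ≤ r → S.bidder r k = i →
      ((twoPhaseERM M τ T₁ c) r (before r b')).utility (x r k) (b' r) k -
        ((twoPhaseERM M τ T₁ c) r (before r b)).utility (x r k) (b r) k ≤ B := by
    intro r k htr hk
    have hbr : b r = Function.update (b' r) k (x r k) := by
      ext j
      by_cases hj : j = k
      · subst hj
        rw [Function.update_self, hb, play_eq_ite, if_pos r.isLt, hk, Function.update_self]
        simp only [Strategy.switch, not_lt.2 htr, if_false, truthful]
        rw [← hk, values_apply]
      · have hne : S.bidder r j ≠ i := fun h => hj (S.injective r (h.trans hk.symm))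
        rw [Function.update_of_ne hj, hb, hb', play_of_bidder_ne S _ _ _ _ hne r.isLt,
          play_of_bidder_ne S _ _ _ _ hne r.isLt]
    rw [hbr]
    unfold twoPhaseERM
    split_ifs with hr
    · have := hM k (x r k) (b' r)
      linarith
    · rw [hfirst b r (not_lt.1 hr), hfirst b' r (not_lt.1 hr)]
      refine secondPrice_utility_sub_le τ _ _ _ _ _ hB ?_
      have hxv : x r k = v r := by
        rw [hx]
        simp [Schedule.withValues, hk]
      rw [hxv]
      exact h r
  rw [← Finset.sum_sub_distrib]
  calc _ ≤ ∑ r ∈ Finset.univ.filter (fun r : Fin T => t ≤ r), if r ∈ S.rounds i then B else 0 := by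
        refine Finset.sum_le_sum fun r hr => ?_
        rw [← Finset.sum_sub_distrib]
        have htr : t ≤ r := by simpa using hr
        by_cases hri : r ∈ S.rounds i
        · rw [if_pos hri]
          obtain ⟨k, hk⟩ : ∃ k, S.bidder r k = i := by simpa [Schedule.rounds] using hri
          rw [Finset.sum_eq_single k]
          · simpa [hk] using hterm r k htr hk
          · intro j _ hj
            have hne : S.bidder r j ≠ i := fun h => hj (S.injective r (h.trans hk.symm))
            simp [hne]
          · simp
        · rw [if_neg hri]
          have hne : ∀ k, S.bidder r k ≠ i := by simpa [Schedule.rounds] using hri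
          simp [hne]
    _ ≤ ∑ r, if r ∈ S.rounds i then B else 0 :=
        Finset.sum_le_sum_of_subset_of_nonneg (Finset.filter_subset _ _) fun r _ _ => by
          split_ifs <;> simp [hB]
    _ = (S.rounds i).card * B := by
        rw [← Finset.sum_filter, Finset.filter_univ_mem, Finset.sum_const, nsmul_eq_mul]

/-- The auction `M` of a first-phase round ignores earlier bids, so by induction the bids in the
rounds of bidder `i`, and what she observes there, depend only on draws in those rounds. From round
`T₁ + 1` on this can fail, since the reserve is disclosed. -/
theorem randomHistory_resample {M : Auction K} (τ : TieBreaking K) {T₁ : ℕ} (c : ℝ) (i : Fin n)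
    (v : Fin T → ℝ≥0) (t : Fin T) (ht : (t : ℕ) ≤ T₁) (ρ : Strategy T K) {k : ℕ}
    (e : Fin k ↪ Fin T × Fin K) (he : ∀ j, (e j).1 ∉ S.rounds i) (ω : Draws T K)
    (w : Fin k → ℝ≥0) :
    S.randomHistory (twoPhaseERM M τ T₁ c) (Function.update (fun _ => truthful T K) i ρ) i v t
        (resample e ω w) =
      S.randomHistory (twoPhaseERM M τ T₁ c) (Function.update (fun _ => truthful T K) i ρ) i v t
        ω := by
  set G : Mechanism T K := twoPhaseERM M τ T₁ c with hG
  have key : ∀ u : ℕ, u ≤ T₁ →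
      S.history G (S.play G (Function.update (fun _ => truthful T K) i ρ)
        (S.withValues i v (resample e ω w).1) ω.2 u) ω.2 u i =
      S.history G (S.play G (Function.update (fun _ => truthful T K) i ρ)
        (S.withValues i v ω.1) ω.2 u) ω.2 u i := by
    intro u
    induction u using Nat.strong_induction_on with
    | _ u ih =>
      intro hu
      have hplay : ∀ r ∈ S.rounds i, (r : ℕ) < u → S.play G
          (Function.update (fun _ => truthful T K) i ρ)
          (S.withValues i v (resample e ω w).1) ω.2 u r =
          S.play G (Function.update (fun _ => truthful T K) i ρ)
          (S.withValues i v ω.1) ω.2 u r := by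
        intro r hr hru
        ext k
        by_cases hk : S.bidder r k = i
        · rw [play_eq_ite, play_eq_ite, if_pos hru, if_pos hru, hk, Function.update_self,
            ih r hru (by omega), values_withValues]
        · rw [play_of_bidder_ne S _ _ _ _ hk hru, play_of_bidder_ne S _ _ _ _ hk hru]
          simp only [Schedule.withValues, hk, if_false, resample]
          rw [Function.extend_apply']
          rintro ⟨j, hj⟩
          exact he j (by rwa [hj])
      ext r k : 2
      unfold Schedule.history
      by_cases h : (r : ℕ) < u ∧ S.bidder r k = i
      · have hr : r ∈ S.rounds i := by
          simp only [Schedule.rounds, Finset.mem_filter, Finset.mem_univ, true_and]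
          exact ⟨k, h.2⟩
        rw [if_pos h, if_pos h, hplay r hr h.1]
        have hGr : ∀ b, G r b = M := fun b => by
          rw [hG]
          unfold twoPhaseERM
          rw [if_pos (by omega)]
        rw [hGr, hGr]
      · rw [if_neg h, if_neg h]
  exact key t ht

end

/-! ### Equilibrium from a pointwise bound on the change of the reserve price -/

theorem exists_embedding_map_univ_eq {α : Type*} (s : Finset α) {n : ℕ} (h : s.card = n) :
    ∃ e : Fin n ↪ α, Finset.univ.map e = s := by
  refine ⟨(s.equivFinOfCardEq h).symm.toEmbedding.trans (Function.Embedding.subtype _), ?_⟩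
  rw [← Finset.map_map, Finset.map_univ_equiv]
  exact Finset.attach_map_val

/-- The two-phase algorithm is `ε`-PBIC if `m · B` has expectation at most `ε`, where
`B` bounds the gain in a later round from all bids of `m` rounds of the first phase. -/
theorem isPBIC_twoPhaseERM {n T T₁ K m : ℕ} (hT : T₁ ≤ T) (hm : m ≤ T₁) (S : Schedule n T K)
    (hS : ∀ i, (S.rounds i).card ≤ m) {M : Auction K} (hM : M.Regular) (hM' : M.Truthful)
    (τ : TieBreaking K) (c : ℝ) {F : Measure ℝ≥0} [IsProbabilityMeasure F] {V : Set ℝ≥0} {ε : ℝ}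
    (hε : 0 ≤ ε) (B : (Fin (T₁ * K - m * K) → ℝ≥0) → ℝ) (hB : ∀ w, 0 ≤ B w)
    (hgain : ∀ v ∈ V, ∀ (a b : Fin (m * K) → ℝ≥0) w,
      min (v : ℝ) (ERM c (pool a w)) - ERM c (pool b w) ≤ B w)
    (hint : ∫⁻ w, ENNReal.ofReal (m * B w) ∂(Measure.pi fun _ => F) ≤ ENNReal.ofReal ε) :
    S.IsPBIC (twoPhaseERM M τ T₁ c) F V ε := by
  classical
  refine isPBIC_of_lintegral_resample_le S (measurableMechanism_twoPhaseERM hM τ T₁ c) hε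
    fun i t v hv ρ => ?_
  by_cases ht : (t : ℕ) < T₁
  · set P : Finset (Fin T) := Finset.univ.filter fun r => (r : ℕ) < T₁ with hP
    have hPcard : P.card = T₁ := by
      rw [hP, Fin.card_filter_val_lt, min_eq_right hT]
    -- The first-phase rounds of bidder `i` are padded to exactly `m` rounds, so that the number of
    -- remaining draws is the one in Δ.
    obtain ⟨R, hR1, hR2, hR3⟩ := Finset.exists_subsuperset_card_eq
      (s := (S.rounds i).filter fun r : Fin T => (r : ℕ) < T₁) (t := P) (n := m)
      (fun r hr => by simpa [hP] using (Finset.mem_filter.1 hr).2)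
      ((Finset.card_filter_le _ _).trans (hS i)) (by omega)
    obtain ⟨ea, hea⟩ := exists_embedding_map_univ_eq (R ×ˢ (Finset.univ : Finset (Fin K)))
      (n := m * K) (by simp [hR3])
    obtain ⟨e, he⟩ := exists_embedding_map_univ_eq ((P \ R) ×ˢ (Finset.univ : Finset (Fin K)))
      (n := T₁ * K - m * K) (by
        rw [Finset.card_product, Finset.card_sdiff_of_subset hR2, hR3, hPcard, Finset.card_univ,
          Fintype.card_fin, Nat.sub_mul])
    have hrange : ∀ j, (e j).1 ∈ P \ R := fun j =>
      (Finset.mem_product.1 (he ▸ Finset.mem_map_of_mem e (Finset.mem_univ j))).1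
    have hnot : ∀ j, (e j).1 ∉ S.rounds i := by
      intro j hj
      have h1 := Finset.mem_sdiff.1 (hrange j)
      exact h1.2 (hR1 (Finset.mem_filter.2 ⟨hj, by simpa [hP] using h1.1⟩))
    have hbids : ∀ b : Table T K, firstPhaseBids T₁ b =
        pool (fun j => b (ea j).1 (ea j).2) (fun j => b (e j).1 (e j).2) := by
      intro b
      have hdisj : Disjoint (Finset.univ.map ea) (Finset.univ.map e) := by
        rw [hea, he]
        exact Finset.disjoint_product.2 (Or.inl Finset.disjoint_sdiff)
      have hunion : P ×ˢ (Finset.univ : Finset (Fin K)) =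
          (Finset.univ.map ea).disjUnion (Finset.univ.map e) hdisj := by
        rw [Finset.disjUnion_eq_union, hea, he, ← Finset.union_product,
          Finset.union_sdiff_of_subset hR2]
      unfold firstPhaseBids pool
      rw [← hP, hunion, Finset.disjUnion_val, Multiset.map_add, Finset.map_val, Finset.map_val,
        Multiset.map_map, Multiset.map_map]
      rfl
    refine ⟨_, e, fun ω w => randomHistory_resample S τ c i v t ht.le ρ e hnot ω w,
      fun σ ω => le_trans (lintegral_mono fun w => ENNReal.ofReal_le_ofReal ?_) hint⟩
    refine (switchUtility_sub_le S hM' τ T₁ c i v t ρ σ (resample e ω w) (hB w) fun r => ?_).trans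
      (mul_le_mul_of_nonneg_right (by exact_mod_cast hS i) (hB w))
    -- The remaining bids are exactly the fresh draws `w`, for the deviation and for truthful
    -- bidding alike.
    have hw : ∀ (ρ' : Strategy T K) (j : Fin (T₁ * K - m * K)),
        S.play (twoPhaseERM M τ T₁ c) (Function.update (fun _ => truthful T K) i ρ')
          (S.withValues i v (resample e ω w).1) (resample e ω w).2 T (e j).1 (e j).2 = w j := by
      intro ρ' j
      have hne : S.bidder (e j).1 (e j).2 ≠ i := fun h => hnot j (by
        simp only [Schedule.rounds, Finset.mem_filter, Finset.mem_univ, true_and]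
        exact ⟨_, h⟩)
      rw [play_of_bidder_ne S _ _ _ _ hne (e j).1.isLt]
      simp only [Schedule.withValues, hne, if_false, resample, Prod.mk.eta,
        e.injective.extend_apply]
    rw [hbids, hbids]
    simp only [hw]
    exact hgain (v r) (hv r) _ _ w
  -- After the first phase the reserve is already determined by bids before `t`, so the gain is at
  -- most 0 pointwise and no resampling is needed.
  · refine ⟨0, ⟨Fin.elim0, fun j => j.elim0⟩,
      fun ω w => by rw [resample_of_isEmpty], fun σ ω => ?_⟩
    · refine le_trans (lintegral_mono (g := fun _ => 0) fun w => ?_) (by simp)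
      rw [nonpos_iff_eq_zero, ENNReal.ofReal_eq_zero]
      refine (switchUtility_sub_le S hM' τ T₁ c i v t ρ σ _ le_rfl fun r => ?_).trans (by simp)
      rw [firstPhaseBids_congr (b := S.play (twoPhaseERM M τ T₁ c)
        (Function.update (fun _ => truthful T K) i (ρ.switch t (truthful T K))) _ _ T)
        (b' := S.play (twoPhaseERM M τ T₁ c)
        (Function.update (fun _ => truthful T K) i (ρ.switch t σ)) _ _ T) fun r' k hr' => ?_]
      · exact sub_nonpos.2 (min_le_right _ _)
      · by_cases hk : S.bidder r' k = i
        · have hlt : r' < t := by rw [Fin.lt_def]; omega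
          rw [play_eq_ite, play_eq_ite, hk, Function.update_self, Function.update_self,
            play_switch S _ ρ (truthful T K) σ _ _ t _ (by omega)]
          simp [Strategy.switch, hlt]
        · rw [play_of_bidder_ne S _ _ _ _ hk r'.isLt, play_of_bidder_ne S _ _ _ _ hk r'.isLt]

/-- If the price is above `v`, lowering it to `v` takes at least as much off the left side as off
the right, because δ ≤ 1. -/
theorem min_sub_le_mul_worstIncentiveMeasure (P : Multiset ℝ≥0 → ℝ≥0) {m k : ℕ} (v : ℝ≥0)
    (a b : Fin m → ℝ≥0) (w : Fin k → ℝ≥0) :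
    min (v : ℝ) (P (pool a w)) - P (pool b w) ≤
      min (v : ℝ) (P (pool a w)) * worstIncentiveMeasure P m w := by
  have h1 := sub_le_mul_worstIncentiveMeasure P a b w
  have h2 := worstIncentiveMeasure_le_one P (m := m) w
  rcases le_total (v : ℝ) (P (pool a w)) with h | h
  · rw [min_eq_left h]
    nlinarith
  · rwa [min_eq_right h]

theorem isPBIC_twoPhaseERM_of_bounded {n T T₁ K m : ℕ} (hT₁ : 0 < T₁) (hT : T₁ ≤ T) (hK : 0 < K)
    (S : Schedule n T K) (hS : ∀ i, (S.rounds i).card ≤ m) {M : Auction K} (hM : M.Regular)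
    (hM' : M.Truthful) (τ : TieBreaking K) {c : ℝ} (hc : c < 1) (F : Measure ℝ≥0)
    [IsProbabilityMeasure F] (D : ℝ≥0) :
    S.IsPBIC (twoPhaseERM M τ T₁ c) F (Set.Icc 1 D)
      ((m : ℝ) * (D : ℝ) * worstDelta (ERM c) F (T₁ * K) (m * K)) := by
  have hε : 0 ≤ (m : ℝ) * (D : ℝ) * worstDelta (ERM c) F (T₁ * K) (m * K) :=
    mul_nonneg (by positivity) (worstDelta_nonneg _ _ _ _)
  by_cases hm : m ≤ T₁
  · refine isPBIC_twoPhaseERM hT hm S hS hM hM' τ c hε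
      (fun w => D * worstIncentiveMeasure (ERM c) (m * K) w)
      (fun w => mul_nonneg D.2 (worstIncentiveMeasure_nonneg _ w)) (fun v hv a b w => ?_) ?_
    · refine (min_sub_le_mul_worstIncentiveMeasure (ERM c) v a b w).trans
        (mul_le_mul_of_nonneg_right ?_ (worstIncentiveMeasure_nonneg _ w))
      exact (min_le_left _ _).trans (by exact_mod_cast hv.2)
    · have hmD : 0 ≤ (m : ℝ) * (D : ℝ) := by positivity
      simp_rw [← mul_assoc, ENNReal.ofReal_mul hmD]
      rw [lintegral_const_mul' _ _ ENNReal.ofReal_ne_top, ofReal_worstDelta]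
  -- For m > T₁ the bound is m D, which holds trivially: no round gains more than the value.
  · rw [worstDelta_ERM_of_le hc F (Nat.mul_pos (by omega) hK) (Nat.mul_le_mul_right K (not_le.1 hm).le),
      mul_one]
    refine isPBIC_of_lintegral_resample_le S (measurableMechanism_twoPhaseERM hM τ T₁ c)
      (by positivity) fun i t v hv ρ => ⟨0, ⟨Fin.elim0, fun j => j.elim0⟩,
      fun ω w => by rw [resample_of_isEmpty], fun σ ω => ?_⟩
    · refine le_trans (lintegral_mono (g := fun _ => ENNReal.ofReal ((m : ℝ) * D)) fun w =>
        ENNReal.ofReal_le_ofReal ?_) (by simp)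
      refine (switchUtility_sub_le S hM' τ T₁ c i v t ρ σ _ (B := D) D.2 fun r => ?_).trans
        (mul_le_mul_of_nonneg_right (by exact_mod_cast hS i) D.2)
      refine (sub_le_self _ (NNReal.coe_nonneg _)).trans ((min_le_left _ _).trans ?_)
      exact_mod_cast (hv r).2

/-! ### Monotone hazard rate distributions -/

theorem measurableEmbedding_nnreal_coe : MeasurableEmbedding NNReal.toReal :=
  MeasurableEmbedding.subtype_coe measurableSet_Ici

theorem comap_volume_Ioc (x y : ℝ≥0) :
    (volume : Measure ℝ).comap NNReal.toReal (Set.Ioc x y) = ENNReal.ofReal (y - x) := by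
  rw [measurableEmbedding_nnreal_coe.comap_apply, NNReal.image_coe_Ioc, Real.volume_Ioc]

theorem comap_volume_singleton (x : ℝ≥0) :
    (volume : Measure ℝ).comap NNReal.toReal {x} = 0 := by
  rw [measurableEmbedding_nnreal_coe.comap_apply, Set.image_singleton, Real.volume_singleton]

/-- A density with monotone hazard rate. -/
structure HasMHRDensity (F : Measure ℝ≥0) (f : ℝ≥0 → ℝ≥0) : Prop where
  measurable : Measurable f
  eq_withDensity :
    F = ((volume : Measure ℝ).comap NNReal.toReal).withDensity (fun x => (f x : ℝ≥0∞))
  monotoneOn : MonotoneOn (fun x => (f x : ℝ) / F.real (Set.Ioi x)) {x | 0 < F.real (Set.Ioi x)}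

section

variable {F : Measure ℝ≥0} {f : ℝ≥0 → ℝ≥0}

theorem HasMHRDensity.apply (hf : HasMHRDensity F f) {s : Set ℝ≥0} (hs : MeasurableSet s) :
    F s = ∫⁻ x in s, f x ∂((volume : Measure ℝ).comap NNReal.toReal) := by
  conv_lhs => rw [hf.eq_withDensity]
  exact withDensity_apply _ hs

theorem HasMHRDensity.singleton (hf : HasMHRDensity F f) (x : ℝ≥0) : F {x} = 0 := by
  rw [hf.apply (measurableSet_singleton x)]
  exact setLIntegral_measure_zero _ _ (comap_volume_singleton x)

theorem hazard_mul (x : ℝ≥0) (hx : 0 < F.real (Set.Ioi x)) :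
    (f x : ℝ) = f x / F.real (Set.Ioi x) * F.real (Set.Ioi x) := by
  rw [div_mul_cancel₀ _ hx.ne']

variable [IsProbabilityMeasure F]

theorem real_Ioi_antitone {x y : ℝ≥0} (h : x ≤ y) : F.real (Set.Ioi y) ≤ F.real (Set.Ioi x) :=
  measureReal_mono (Set.Ioi_subset_Ioi h)

theorem real_Ioc_eq_sub {x y : ℝ≥0} (h : x ≤ y) :
    F.real (Set.Ioc x y) = F.real (Set.Ioi x) - F.real (Set.Ioi y) := by
  rw [← Set.Ioc_union_Ioi_eq_Ioi h, measureReal_union (Set.Ioc_disjoint_Ioi le_rfl)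
    measurableSet_Ioi]
  ring

namespace HasMHRDensity

/-- On (x, y] the density, being hazard times tail, is at most the hazard at `z` times the tail at
`x`. -/
theorem sub_le_hazard_mul (hf : HasMHRDensity F f) {x y z : ℝ≥0} (hxy : x ≤ y) (hyz : y ≤ z)
    (hz : 0 < F.real (Set.Ioi z)) :
    F.real (Set.Ioi x) - F.real (Set.Ioi y) ≤
      (f z : ℝ) / F.real (Set.Ioi z) * (y - x) * F.real (Set.Ioi x) := by
  have hxy' : (0 : ℝ) ≤ y - x := sub_nonneg.2 (NNReal.coe_le_coe.2 hxy)
  have hC : 0 ≤ (f z : ℝ) / F.real (Set.Ioi z) * F.real (Set.Ioi x) := by positivity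
  rw [← real_Ioc_eq_sub hxy, measureReal_def, hf.apply measurableSet_Ioc]
  refine ENNReal.toReal_le_of_le_ofReal (by positivity) ?_
  calc _ ≤ ∫⁻ u in Set.Ioc x y, ENNReal.ofReal ((f z : ℝ) / F.real (Set.Ioi z) *
          F.real (Set.Ioi x)) ∂((volume : Measure ℝ).comap NNReal.toReal) := by
        refine setLIntegral_mono measurable_const fun u hu => ?_
        have huz : u ≤ z := hu.2.trans hyz
        have hSu : 0 < F.real (Set.Ioi u) := hz.trans_le (real_Ioi_antitone huz)
        rw [← ENNReal.ofReal_coe_nnreal, hazard_mul u hSu]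
        refine ENNReal.ofReal_le_ofReal (mul_le_mul (hf.monotoneOn hSu hz huz)
          (real_Ioi_antitone hu.1.le) hSu.le (by positivity))
    _ = _ := by
        rw [setLIntegral_const, comap_volume_Ioc, ← ENNReal.ofReal_mul hC]
        ring_nf

theorem hazard_mul_le_sub (hf : HasMHRDensity F f) {x y : ℝ≥0} (hxy : x ≤ y)
    (hy : 0 < F.real (Set.Ioi y)) :
    (f x : ℝ) / F.real (Set.Ioi x) * (y - x) * F.real (Set.Ioi y) ≤
      F.real (Set.Ioi x) - F.real (Set.Ioi y) := by
  have hC : 0 ≤ (f x : ℝ) / F.real (Set.Ioi x) * F.real (Set.Ioi y) := by positivity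
  rw [← real_Ioc_eq_sub hxy, measureReal_def F (Set.Ioc x y)]
  refine (ENNReal.ofReal_le_iff_le_toReal (measure_ne_top _ _)).1 ?_
  rw [hf.apply measurableSet_Ioc]
  calc _ = ∫⁻ u in Set.Ioc x y, ENNReal.ofReal ((f x : ℝ) / F.real (Set.Ioi x) *
          F.real (Set.Ioi y)) ∂((volume : Measure ℝ).comap NNReal.toReal) := by
        rw [setLIntegral_const, comap_volume_Ioc, ← ENNReal.ofReal_mul hC]
        ring_nf
    _ ≤ _ := by
        refine setLIntegral_mono hf.measurable.coe_nnreal_ennreal fun u hu => ?_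
        have hSu : 0 < F.real (Set.Ioi u) := hy.trans_le (real_Ioi_antitone hu.2)
        have hSx : 0 < F.real (Set.Ioi x) := hSu.trans_le (real_Ioi_antitone hu.1.le)
        rw [← ENNReal.ofReal_coe_nnreal (p := f u), hazard_mul u hSu]
        exact ENNReal.ofReal_le_ofReal (mul_le_mul (hf.monotoneOn hSx hSu hu.1.le)
          (real_Ioi_antitone hu.2) hy.le (by positivity))

theorem real_Ioi_zero (hf : HasMHRDensity F f) : F.real (Set.Ioi 0) = 1 := by
  have h : (Set.Ioi (0 : ℝ≥0)) = {0}ᶜ := by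
    ext x
    simp [pos_iff_ne_zero]
  rw [h, probReal_compl_eq_one_sub (measurableSet_singleton 0), measureReal_def, hf.singleton]
  simp

variable {p : ℝ≥0}

theorem monopoly_pos (hf : HasMHRDensity F f) (hp : IsMonopolyPrice F p) :
    0 < p ∧ 0 < F.real (Set.Ioi p) := by
  have h : ∃ q : ℝ≥0, 0 < q ∧ 0 < F.real (Set.Ioi q) := by
    by_contra! hcon
    have h0 : F (Set.Ioi 0) = 0 := by
      refine measure_mono_null (t := ⋃ n : ℕ, Set.Ioi (1 / ((n : ℝ≥0) + 1))) (fun x hx => ?_)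
        (measure_iUnion_null fun n => ?_)
      · obtain ⟨n, hn⟩ := exists_nat_one_div_lt (K := ℝ≥0) hx
        exact Set.mem_iUnion.2 ⟨n, hn⟩
      · have := le_antisymm (hcon (1 / ((n : ℝ≥0) + 1)) (by positivity)) measureReal_nonneg
        rwa [measureReal_eq_zero_iff] at this
    have h1 := hf.real_Ioi_zero
    rw [measureReal_def, h0] at h1
    simp at h1
  obtain ⟨q, hq, hSq⟩ := h
  have hpos : 0 < (p : ℝ) * F.real (Set.Ioi p) := (mul_pos (by exact_mod_cast hq) hSq).trans_le (hp q)
  have h2 := pos_of_mul_pos_left hpos measureReal_nonneg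
  exact ⟨by exact_mod_cast h2, pos_of_mul_pos_right hpos h2.le⟩

/-- First-order condition for revenue in difference form: with S the tail and h the hazard, y h(y)
(p - y) S(p) ≤ y (S(y) - S(p)) ≤ (p - y) S(p). No differentiability is needed. -/
theorem mul_hazard_le_one (hf : HasMHRDensity F f) (hp : IsMonopolyPrice F p) {y : ℝ≥0}
    (hy : y < p) : (y : ℝ) * ((f y : ℝ) / F.real (Set.Ioi y)) ≤ 1 := by
  obtain ⟨-, hSp⟩ := hf.monopoly_pos hp
  have h1 := hf.hazard_mul_le_sub hy.le hSp
  have h2 := hp y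
  set h := (f y : ℝ) / F.real (Set.Ioi y)
  have hy' : (0 : ℝ) < p - y := sub_pos.2 (by exact_mod_cast hy)
  have h3 := mul_le_mul_of_nonneg_left h1 y.2
  have h4 : (y : ℝ) * h * ((p - y) * F.real (Set.Ioi p)) ≤ 1 * ((p - y) * F.real (Set.Ioi p)) := by
    simp only [NNReal.val_eq_coe] at h3
    linarith
  exact le_of_mul_le_mul_right h4 (by positivity)

/-- The mirror image above p: y h(y) (y - p) S(p) ≥ y (S(p) - S(y)) ≥ (y - p) S(p). -/
theorem one_le_mul_hazard (hf : HasMHRDensity F f) (hp : IsMonopolyPrice F p) {y : ℝ≥0}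
    (hy : p < y) (hSy : 0 < F.real (Set.Ioi y)) :
    1 ≤ (y : ℝ) * ((f y : ℝ) / F.real (Set.Ioi y)) := by
  obtain ⟨-, hSp⟩ := hf.monopoly_pos hp
  have h1 := hf.sub_le_hazard_mul hy.le le_rfl hSy
  have h2 := hp y
  set h := (f y : ℝ) / F.real (Set.Ioi y)
  have hy' : (0 : ℝ) < y - p := sub_pos.2 (by exact_mod_cast hy)
  have h3 := mul_le_mul_of_nonneg_left h1 y.2
  have h4 : 1 * ((y - p) * F.real (Set.Ioi p)) ≤ (y : ℝ) * h * ((y - p) * F.real (Set.Ioi p)) := by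
    simp only [NNReal.val_eq_coe] at h3
    linarith
  exact le_of_mul_le_mul_right h4 (by positivity)

/-- A quarter of the monopoly price is accepted with probability at least `1 / 2`. -/
theorem half_le_real_Ioi (hf : HasMHRDensity F f) (hp : IsMonopolyPrice F p) :
    1 / 2 ≤ F.real (Set.Ioi (p / 4)) := by
  obtain ⟨hp0, hSp⟩ := hf.monopoly_pos hp
  have hlt : p / 2 < p := NNReal.half_lt_self hp0.ne'
  have hle : p / 4 ≤ p / 2 := by gcongr; norm_num
  have hS : 0 < F.real (Set.Ioi (p / 2)) := hSp.trans_le (real_Ioi_antitone hlt.le)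
  -- The hazard at p/2 is at most 2/p, so over the length p/4 the tail loses at most 1/2.
  have h1 := hf.sub_le_hazard_mul (zero_le (a := p / 4)) hle hS
  have h2 := hf.mul_hazard_le_one hp hlt
  rw [hf.real_Ioi_zero] at h1
  push_cast at h1 h2
  linarith

theorem real_Ioi_le_mul (hf : HasMHRDensity F f) (hp : IsMonopolyPrice F p) {x : ℝ≥0}
    (hx : 2 * p ≤ x) : F.real (Set.Ioi x) ≤ 2 * p * f x := by
  obtain ⟨hp0, hSp⟩ := hf.monopoly_pos hp
  rcases eq_or_lt_of_le (measureReal_nonneg (μ := F) (s := Set.Ioi x)) with h | h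
  · rw [← h]
    positivity
  · have hS : 0 < F.real (Set.Ioi (2 * p)) := h.trans_le (real_Ioi_antitone hx)
    have hlt : p < 2 * p := by
      rw [two_mul]
      exact lt_add_of_pos_right p hp0
    have h1 := hf.one_le_mul_hazard hp hlt hS
    have h2 := hf.monotoneOn hS h hx
    have h3 : 1 ≤ ((2 * p : ℝ≥0) : ℝ) * ((f x : ℝ) / F.real (Set.Ioi x)) :=
      h1.trans (mul_le_mul_of_nonneg_left h2 (NNReal.coe_nonneg _))
    rw [← mul_div_assoc, le_div_iff₀ h, one_mul] at h3
    exact_mod_cast h3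

/-- Layer cake formula for the moment: up to 2p the tail is bounded by 1, and beyond 2p by 2p times
the density, which brings back the moment of one order less. -/
theorem lintegral_pow_succ_le (hf : HasMHRDensity F f) (hp : IsMonopolyPrice F p) (k : ℕ) :
    ∫⁻ x, (x : ℝ≥0∞) ^ (k + 1) ∂F ≤
      ((2 * p : ℝ≥0) : ℝ≥0∞) ^ (k + 1) +
        (k + 1 : ℕ) * ((2 * p : ℝ≥0) : ℝ≥0∞) * ∫⁻ x, (x : ℝ≥0∞) ^ k ∂F := by
  set a : ℝ≥0 := 2 * p with ha
  set g : ℝ → ℝ := fun t => ((k + 1 : ℕ) : ℝ) * t ^ k with hg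
  have hgc : Continuous g := by fun_prop
  have hint : ∀ y : ℝ, ∫ t in (0 : ℝ)..y, g t = y ^ (k + 1) := by
    intro y
    have : ((k : ℝ) + 1) ≠ 0 := by positivity
    simp only [hg, intervalIntegral.integral_const_mul, integral_pow]
    push_cast
    field_simp
    simp
  have h1 := lintegral_comp_eq_lintegral_meas_lt_mul F (f := NNReal.toReal) (g := g)
    (Eventually.of_forall fun x => NNReal.coe_nonneg x) measurable_coe_nnreal_real.aemeasurable
    (fun t _ => hgc.intervalIntegrable 0 t)
    ((ae_restrict_mem measurableSet_Ioi).mono fun t ht => by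
      have : (0 : ℝ) < t := ht
      simp only [hg]
      positivity)
  simp_rw [hint] at h1
  have h2 : ∀ x : ℝ≥0, ENNReal.ofReal ((x : ℝ) ^ (k + 1)) = (x : ℝ≥0∞) ^ (k + 1) := by
    intro x
    rw [ENNReal.ofReal_pow (NNReal.coe_nonneg x), ENNReal.ofReal_coe_nnreal]
  simp_rw [h2] at h1
  rw [h1]
  have hbound : ∀ t ∈ Set.Ioi (0 : ℝ), F {x : ℝ≥0 | t < (x : ℝ)} * ENNReal.ofReal (g t) ≤
      (Set.Ioc 0 (a : ℝ)).indicator (fun t => ENNReal.ofReal (g t)) t +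
        (a : ℝ≥0∞) * f t.toNNReal * ENNReal.ofReal (g t) := by
    intro t ht
    by_cases hta : t ≤ a
    · rw [Set.indicator_of_mem (show t ∈ Set.Ioc 0 (a : ℝ) from ⟨ht, hta⟩)]
      refine le_trans ?_ le_self_add
      exact (mul_le_mul_left prob_le_one _).trans_eq (one_mul _)
    · refine le_trans (mul_le_mul_left ?_ _) le_add_self
      have ht0 : (0 : ℝ) ≤ t := le_of_lt ht
      have hset : {x : ℝ≥0 | t < (x : ℝ)} = Set.Ioi t.toNNReal := by
        ext x
        simp only [Set.mem_ofPred_eq, Set.mem_Ioi]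
        rw [← NNReal.coe_lt_coe, Real.coe_toNNReal _ ht0]
      have h3 := hf.real_Ioi_le_mul hp (x := t.toNNReal) (by
        rw [← NNReal.coe_le_coe, Real.coe_toNNReal _ ht0]
        exact (not_le.1 hta).le)
      rw [hset, ← ENNReal.coe_mul, ← ENNReal.ofReal_coe_nnreal, ← ofReal_measureReal]
      refine ENNReal.ofReal_le_ofReal ?_
      push_cast [ha]
      exact h3
  refine (setLIntegral_mono' measurableSet_Ioi hbound).trans ?_
  have hgm : Measurable fun t => ENNReal.ofReal (g t) := hgc.measurable.ennreal_ofReal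
  rw [lintegral_add_left (hgm.indicator measurableSet_Ioc)]
  refine add_le_add ?_ ?_
  · rw [lintegral_indicator measurableSet_Ioc, Measure.restrict_restrict measurableSet_Ioc]
    have hsub : Set.Ioc 0 (a : ℝ) ∩ Set.Ioi 0 = Set.Ioc 0 (a : ℝ) :=
      Set.inter_eq_left.2 fun t ht => ht.1
    rw [hsub, ← ofReal_integral_eq_lintegral_ofReal
      (hgc.integrableOn_Ioc) ((ae_restrict_mem measurableSet_Ioc).mono fun t ht => by
        have : (0 : ℝ) < t := ht.1
        simp only [hg, Pi.zero_apply]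
        positivity), ← intervalIntegral.integral_of_le (NNReal.coe_nonneg a), hint, h2]
  · calc _ ≤ ∫⁻ t in Set.range NNReal.toReal, (a : ℝ≥0∞) * f t.toNNReal * ENNReal.ofReal (g t) :=
          lintegral_mono_set fun t ht => ⟨⟨t, le_of_lt ht⟩, rfl⟩
      _ = ∫⁻ x : ℝ≥0, (a : ℝ≥0∞) * f x * ENNReal.ofReal (g x)
            ∂((volume : Measure ℝ).comap NNReal.toReal) := by
          rw [← measurableEmbedding_nnreal_coe.map_comap,
            measurableEmbedding_nnreal_coe.lintegral_map]
          simp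
      _ = ∫⁻ x : ℝ≥0, f x * (((k + 1 : ℕ) * (a : ℝ≥0∞)) * (x : ℝ≥0∞) ^ k)
            ∂((volume : Measure ℝ).comap NNReal.toReal) := by
          refine lintegral_congr fun x => ?_
          simp only [hg]
          rw [ENNReal.ofReal_mul (by positivity), ENNReal.ofReal_pow (NNReal.coe_nonneg x),
            ENNReal.ofReal_coe_nnreal, ENNReal.ofReal_natCast]
          ring
      _ = ∫⁻ x : ℝ≥0, ((k + 1 : ℕ) * (a : ℝ≥0∞)) * (x : ℝ≥0∞) ^ k ∂F := by
          conv_rhs => rw [hf.eq_withDensity]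
          rw [lintegral_withDensity_eq_lintegral_mul _ hf.measurable.coe_nnreal_ennreal
            (by fun_prop)]
          rfl
      _ = _ := by
          rw [lintegral_const_mul _ (by fun_prop)]

theorem lintegral_pow_two_le (hf : HasMHRDensity F f) (hp : IsMonopolyPrice F p) :
    ∫⁻ x, (x : ℝ≥0∞) ^ 2 ∂F ≤ ((20 * p ^ 2 : ℝ≥0) : ℝ≥0∞) := by
  have h1 := hf.lintegral_pow_succ_le hp 0
  have h2 := hf.lintegral_pow_succ_le hp 1
  simp only [pow_zero, lintegral_one, measure_univ, zero_add, pow_one] at h1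
  refine (h2.trans (add_le_add_right (mul_le_mul_right ?_ _) _)).trans_eq
    (b := ((2 * p : ℝ≥0) : ℝ≥0∞) ^ 2 + (2 : ℕ) * ((2 * p : ℝ≥0) : ℝ≥0∞) * ((4 * p : ℝ≥0) : ℝ≥0∞)) ?_
  · simp only [pow_one]
    refine h1.trans_eq ?_
    norm_cast
    ring
  · norm_cast
    ring

/-- The recursion gives 4p and 20p², then 8 + 6·20 = 128 for p³ and 16 + 8·128 = 1040 for p⁴. -/
theorem lintegral_pow_four_le (hf : HasMHRDensity F f) (hp : IsMonopolyPrice F p) :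
    ∫⁻ x, (x : ℝ≥0∞) ^ 4 ∂F ≤ ((1040 * p ^ 4 : ℝ≥0) : ℝ≥0∞) := by
  have h2 := hf.lintegral_pow_two_le hp
  have h3 := hf.lintegral_pow_succ_le hp 2
  have h4 := hf.lintegral_pow_succ_le hp 3
  refine (h4.trans (add_le_add_right (mul_le_mul_right (h3.trans
    (add_le_add_right (mul_le_mul_right h2 _) _)) _) _)).trans_eq ?_
  norm_cast
  ring

end HasMHRDensity

end

/-! ### Concentration of sums over independent samples -/

theorem pi_real_chebyshev {k : ℕ} (F : Measure ℝ≥0) [IsProbabilityMeasure F] {g : ℝ≥0 → ℝ}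
    (hg : Measurable g) (hg2 : MemLp g 2 F) {t : ℝ} (ht : 0 < t) {v : ℝ}
    (hv : ∫ x, g x ^ 2 ∂F ≤ v) :
    (Measure.pi fun _ : Fin k => F) {w | t ≤ |∑ j, g (w j) - k * ∫ x, g x ∂F|} ≤
      ENNReal.ofReal (k * v / t ^ 2) := by
  have hmem : ∀ j : Fin k, MemLp (fun w : Fin k → ℝ≥0 => g (w j)) 2
      (Measure.pi fun _ : Fin k => F) := fun j =>
    hg2.comp_measurePreserving (measurePreserving_eval (fun _ : Fin k => F) j)
  have hmemsum : MemLp (∑ j, fun w : Fin k → ℝ≥0 => g (w j)) 2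
      (Measure.pi fun _ : Fin k => F) := memLp_finsetSum' _ fun j _ => hmem j
  have hexp : ∀ j : Fin k, ∫ w : Fin k → ℝ≥0, g (w j) ∂(Measure.pi fun _ : Fin k => F) =
      ∫ x, g x ∂F := fun j =>
    integral_comp_eval (μ := fun _ : Fin k => F) hg.aestronglyMeasurable
  have hmean : ∫ w, (∑ j, fun w : Fin k → ℝ≥0 => g (w j)) w ∂(Measure.pi fun _ : Fin k => F) =
      k * ∫ x, g x ∂F := by
    simp only [Finset.sum_apply]
    rw [integral_finsetSum _ fun j _ => (hmem j).integrable one_le_two]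
    simp [hexp]
  have hvar : variance (∑ j, fun w : Fin k → ℝ≥0 => g (w j)) (Measure.pi fun _ : Fin k => F) ≤
      k * v := by
    rw [variance_sum_pi (μ := fun _ : Fin k => F) (X := fun _ => g) fun _ => hg2]
    calc _ ≤ ∑ _j : Fin k, v := Finset.sum_le_sum fun j _ =>
          (variance_le_expectation_sq hg.aestronglyMeasurable).trans hv
      _ = _ := by simp
  have h := meas_ge_le_variance_div_sq hmemsum ht
  rw [hmean] at h
  simp only [Finset.sum_apply] at h
  refine h.trans (ENNReal.ofReal_le_ofReal ?_)
  gcongr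

/-! ### The guarded reserve price is rarely large -/

theorem card_filter_pool {m k : ℕ} (a : Fin m → ℝ≥0) (w : Fin k → ℝ≥0) (x : ℝ≥0) :
    ((pool a w).filter (x ≤ ·)).card =
      (Finset.univ.filter fun j => x ≤ a j).card + (Finset.univ.filter fun j => x ≤ w j).card := by
  simp only [pool, Multiset.filter_add, Multiset.card_add, Multiset.filter_map, Multiset.card_map]
  rfl

theorem card_filter_pool_le {m k : ℕ} (a : Fin m → ℝ≥0) (w : Fin k → ℝ≥0) (x : ℝ≥0) :
    ((pool a w).filter (x ≤ ·)).card ≤ m + (Finset.univ.filter fun j => x ≤ w j).card := by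
  rw [card_filter_pool]
  gcongr
  exact (Finset.card_filter_le _ _).trans_eq (by simp)

/-- If at least `m` samples are guarded against, the price is at most one of the other samples. -/
theorem exists_ERM_pool_le {m k : ℕ} {c : ℝ} (hc : c < 1) (hk : 0 < m + k)
    (hcm : (m : ℝ) ≤ c * (m + k : ℕ)) (a : Fin m → ℝ≥0) (w : Fin k → ℝ≥0)
    (hpos : 0 < ERM c (pool a w)) : ∃ j, ERM c (pool a w) ≤ w j := by
  obtain ⟨i, hi, hE, -⟩ := exists_ERM_eq_kthLargest hc (s := pool a w) (by rwa [card_pool])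
  have hi' := mem_guardedIndices.1 hi
  rw [card_pool] at hi'
  have h1 := (le_kthLargest_iff hpos _ hi'.1.1).1 hE.le
  have h2 := h1.trans (card_filter_pool_le a w _)
  -- The guard puts the chosen index beyond the number of manipulable samples, so they cannot alone
  -- account for it.
  have h3 : m < i := by exact_mod_cast hcm.trans_lt hi'.2
  have h4 : 0 < (Finset.univ.filter fun j => ERM c (pool a w) ≤ w j).card := by omega
  obtain ⟨j, hj⟩ := Finset.card_pos.1 h4
  exact ⟨j, (Finset.mem_filter.1 hj).2⟩

/-- The revenue of the chosen price on the samples is at least that of the price `z`, if the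
latter is guarded. -/
theorem card_mul_le_ERM_pool {m k : ℕ} {c : ℝ} (hc : c < 1) (a : Fin m → ℝ≥0)
    (w : Fin k → ℝ≥0) {z : ℝ≥0} (hz : 0 < z)
    (hcz : c * (m + k : ℕ) < ((Finset.univ.filter fun j => z ≤ w j).card : ℝ))
    (hpos : 0 < (Finset.univ.filter fun j => z ≤ w j).card) :
    ((Finset.univ.filter fun j => z ≤ w j).card : ℝ) * z ≤
      (m + (Finset.univ.filter fun j => ERM c (pool a w) ≤ w j).card) * ERM c (pool a w) := by
  set A := (Finset.univ.filter fun j => z ≤ w j).card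
  have hAk : A ≤ k := (Finset.card_filter_le _ _).trans_eq (by simp)
  obtain ⟨i, hi, hE, hmax⟩ := exists_ERM_eq_kthLargest hc (s := pool a w)
    (by rw [card_pool]; omega)
  have hi' := mem_guardedIndices.1 hi
  have hA : A ≤ ((pool a w).filter (z ≤ ·)).card := by
    rw [card_filter_pool]
    exact Nat.le_add_left _ _
  have h1 := hmax A (mem_guardedIndices.2 ⟨⟨hpos, by rw [card_pool]; omega⟩, by
    rwa [card_pool]⟩)
  rw [← hE] at h1
  have h2 : z ≤ kthLargest (pool a w) A := (le_kthLargest_iff hz _ hpos).2 hA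
  have h3 : (A : ℝ≥0) * z ≤ i * ERM c (pool a w) := (mul_le_mul_right h2 _).trans h1
  have h4 : 0 < ERM c (pool a w) := by
    rw [pos_iff_ne_zero]
    intro h0
    rw [h0, mul_zero] at h3
    have : (0 : ℝ≥0) < A * z := mul_pos (by exact_mod_cast hpos) hz
    exact absurd h3 (not_le.2 this)
  have h5 := ((le_kthLargest_iff h4 _ hi'.1.1).1 hE.le).trans (card_filter_pool_le a w _)
  have h6 : (A : ℝ) * z ≤ i * ERM c (pool a w) := by exact_mod_cast h3
  refine h6.trans (mul_le_mul_of_nonneg_right ?_ (NNReal.coe_nonneg _))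
  exact_mod_cast h5

/-- If `z = p / 4` is accepted by a quarter of the samples and the second moment of the samples is
not large, then the guarded price is at most a multiple of `p`, unless it is huge. -/
theorem ERM_pool_le_mul {m k : ℕ} {c : ℝ} (hc : c ≤ 1 / 8) (a : Fin m → ℝ≥0) (w : Fin k → ℝ≥0)
    {p : ℝ≥0} (hp : 0 < p) {N : ℝ} (hN : N = (m + k : ℕ)) (hN0 : 0 < N)
    (hm : (m : ℝ) ≤ Real.sqrt N / 32)
    (hE : (ERM c (pool a w) : ℝ) ≤ Real.sqrt N * p)
    (hz : N / 4 ≤ ((Finset.univ.filter fun j => p / 4 ≤ w j).card : ℝ))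
    (h2 : ∑ j, (w j : ℝ) ^ 2 ≤ 40 * p ^ 2 * N) :
    (ERM c (pool a w) : ℝ) ≤ 1280 * p := by
  have hp' : (0 : ℝ) < p := by exact_mod_cast hp
  have hpos : 0 < (Finset.univ.filter fun j => p / 4 ≤ w j).card := by
    have : (0 : ℝ) < (Finset.univ.filter fun j => p / 4 ≤ w j).card := by linarith
    exact_mod_cast this
  have h1 := card_mul_le_ERM_pool (c := c) (by linarith) a w (z := p / 4) (by positivity)
    (by rw [← hN]; nlinarith) hpos
  set e : ℝ := ((ERM c (pool a w) : ℝ≥0) : ℝ)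
  set Y : ℝ := ((Finset.univ.filter fun j => ERM c (pool a w) ≤ w j).card : ℝ)
  have he0 : 0 ≤ e := NNReal.coe_nonneg _
  -- The manipulable samples carry at most half of the revenue Np/16 guaranteed by the price p/4.
  have hme : m * e ≤ N * p / 32 := by
    calc (m : ℝ) * e ≤ (Real.sqrt N / 32) * (Real.sqrt N * p) := by gcongr
      _ = (Real.sqrt N * Real.sqrt N) * p / 32 := by ring
      _ = N * p / 32 := by rw [Real.mul_self_sqrt hN0.le]
  have h3 : N / 4 * (p / 4) ≤ (m + Y) * e := by
    refine le_trans ?_ h1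
    push_cast
    gcongr
  have h4 : N * p / 32 ≤ Y * e := by linarith
  -- Markov's inequality for the squares; combined with Y e ≥ Np/32 it gives e ≤ 32 · 40 p.
  have h5 : Y * e ^ 2 ≤ ∑ j, (w j : ℝ) ^ 2 := by
    calc Y * e ^ 2 = ∑ j ∈ Finset.univ.filter fun j => ERM c (pool a w) ≤ w j, e ^ 2 := by
          rw [Finset.sum_const, nsmul_eq_mul]
      _ ≤ ∑ j ∈ Finset.univ.filter fun j => ERM c (pool a w) ≤ w j, (w j : ℝ) ^ 2 := by
          refine Finset.sum_le_sum fun j hj => ?_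
          have : e ≤ w j := by exact_mod_cast (Finset.mem_filter.1 hj).2
          gcongr
      _ ≤ _ := Finset.sum_le_sum_of_subset_of_nonneg (Finset.filter_subset _ _)
          fun j _ _ => by positivity
  have h6 : (N * p / 32) * e ≤ (N * p / 32) * (1280 * p) := by
    calc (N * p / 32) * e ≤ Y * e * e := by gcongr
      _ = Y * e ^ 2 := by ring
      _ ≤ 40 * p ^ 2 * N := h5.trans h2
      _ = _ := by ring
  exact le_of_mul_le_mul_left h6 (by positivity)

/-! ### The two-phase algorithm for monotone hazard rate distributions -/

theorem integral_pow_le_of_lintegral {F : Measure ℝ≥0} {k : ℕ} {C : ℝ≥0}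
    (h : ∫⁻ x, (x : ℝ≥0∞) ^ k ∂F ≤ C) : ∫ x, (x : ℝ) ^ k ∂F ≤ C := by
  rw [integral_eq_lintegral_of_nonneg_ae (Eventually.of_forall fun x => by positivity)
    (by fun_prop)]
  refine ENNReal.toReal_le_of_le_ofReal C.2 ?_
  rw [ENNReal.ofReal_coe_nnreal]
  refine le_trans (le_of_eq (lintegral_congr fun x => ?_)) h
  rw [ENNReal.ofReal_pow (NNReal.coe_nonneg x), ENNReal.ofReal_coe_nnreal]

namespace HasMHRDensity

variable {F : Measure ℝ≥0} [IsProbabilityMeasure F] {f : ℝ≥0 → ℝ≥0} {p : ℝ≥0}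

theorem integrable_pow_four (hf : HasMHRDensity F f) (hp : IsMonopolyPrice F p) :
    Integrable (fun x : ℝ≥0 => (x : ℝ) ^ 4) F := by
  refine ⟨by fun_prop, ?_⟩
  rw [hasFiniteIntegral_iff_ofReal (Eventually.of_forall fun x => by positivity)]
  refine lt_of_le_of_lt ?_ (ENNReal.coe_lt_top (r := 1040 * p ^ 4))
  refine le_trans (le_of_eq (lintegral_congr fun x => ?_)) (hf.lintegral_pow_four_le hp)
  rw [ENNReal.ofReal_pow (NNReal.coe_nonneg x), ENNReal.ofReal_coe_nnreal]

theorem lintegral_sum_pow_four_le (hf : HasMHRDensity F f) (hp : IsMonopolyPrice F p) (k : ℕ) :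
    ∫⁻ w, ENNReal.ofReal (∑ j, (w j : ℝ) ^ 4) ∂(Measure.pi fun _ : Fin k => F) ≤
      ENNReal.ofReal (k * (1040 * p ^ 4)) := by
  have h : ∀ w : Fin k → ℝ≥0, ENNReal.ofReal (∑ j, (w j : ℝ) ^ 4) = ∑ j, (w j : ℝ≥0∞) ^ 4 := by
    intro w
    rw [ENNReal.ofReal_sum_of_nonneg fun j _ => by positivity]
    refine Finset.sum_congr rfl fun j _ => ?_
    rw [ENNReal.ofReal_pow (NNReal.coe_nonneg _), ENNReal.ofReal_coe_nnreal]
  simp_rw [h]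
  rw [lintegral_finsetSum _ fun j _ => by fun_prop]
  have h1 : ∀ j : Fin k, ∫⁻ w : Fin k → ℝ≥0, (w j : ℝ≥0∞) ^ 4 ∂(Measure.pi fun _ => F) =
      ∫⁻ x, (x : ℝ≥0∞) ^ 4 ∂F := fun j =>
    (measurePreserving_eval (fun _ : Fin k => F) j).lintegral_comp
      (f := fun x : ℝ≥0 => (x : ℝ≥0∞) ^ 4) (by fun_prop)
  simp_rw [h1]
  rw [Finset.sum_const, Finset.card_univ, Fintype.card_fin, nsmul_eq_mul,
    ENNReal.ofReal_mul (Nat.cast_nonneg k), ENNReal.ofReal_natCast]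
  refine mul_le_mul_right ((hf.lintegral_pow_four_le hp).trans_eq ?_) _
  rw [← ENNReal.ofReal_coe_nnreal]
  push_cast
  rfl

/-- The mean count is at least 31N/64, which exceeds N/4 by more than N/5; Chebyshev with that
deviation gives 25/N. -/
theorem pi_few_above_le (hf : HasMHRDensity F f) (hp : IsMonopolyPrice F p) {k : ℕ} {N : ℝ}
    (hN : 0 < N) (hkN : k ≤ N) (hk : 31 / 32 * N ≤ k) :
    (Measure.pi fun _ : Fin k => F)
        {w | ((Finset.univ.filter fun j => p / 4 ≤ w j).card : ℝ) < N / 4} ≤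
      ENNReal.ofReal (25 / N) := by
  classical
  set g : ℝ≥0 → ℝ := (Set.Ici (p / 4)).indicator fun _ => 1 with hg
  have hgm : Measurable g := measurable_const.indicator measurableSet_Ici
  have hint : ∫ x, g x ∂F = F.real (Set.Ici (p / 4)) := by
    rw [hg, integral_indicator_const _ measurableSet_Ici, smul_eq_mul, mul_one]
  have hmean : 1 / 2 ≤ ∫ x, g x ∂F := by
    rw [hint]
    exact (hf.half_le_real_Ioi hp).trans (measureReal_mono Set.Ioi_subset_Ici_self)
  have hsq : ∫ x, g x ^ 2 ∂F ≤ 1 := by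
    have : (fun x => g x ^ 2) = g := by
      ext x
      simp only [hg, Set.indicator_apply]
      split_ifs <;> simp
    rw [this, hint]
    exact measureReal_le_one
  have hcheb := pi_real_chebyshev (k := k) F hgm
    (memLp_indicator_const 2 measurableSet_Ici 1 (Or.inr (measure_ne_top _ _)))
    (t := N / 5) (by positivity) hsq
  refine (measure_mono fun w hw => ?_).trans (hcheb.trans (ENNReal.ofReal_le_ofReal ?_))
  · have hsum : ∑ j, g (w j) = ((Finset.univ.filter fun j => p / 4 ≤ w j).card : ℝ) := by
      simp [hg, Set.indicator_apply]
    have hw' : ((Finset.univ.filter fun j => p / 4 ≤ w j).card : ℝ) < N / 4 := hw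
    simp only [Set.mem_ofPred_eq, hsum]
    refine le_trans ?_ (neg_le_abs _)
    nlinarith
  · rw [div_le_div_iff₀ (by positivity) hN]
    nlinarith

/-- Chebyshev with mean at most 20p²N and deviation 20p²N gives 1040/400 < 3. -/
theorem pi_large_sq_le (hf : HasMHRDensity F f) (hp : IsMonopolyPrice F p) {k : ℕ} {N : ℝ}
    (hN : 0 < N) (hkN : k ≤ N) :
    (Measure.pi fun _ : Fin k => F) {w | 40 * p ^ 2 * N < ∑ j, (w j : ℝ) ^ 2} ≤
      ENNReal.ofReal (3 / N) := by
  have hp0 : (0 : ℝ) < p := by exact_mod_cast (hf.monopoly_pos hp).1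
  have h4 := hf.integrable_pow_four hp
  have hsq : ∫ x : ℝ≥0, ((x : ℝ) ^ 2) ^ 2 ∂F ≤ 1040 * p ^ 4 := by
    simp_rw [← pow_mul]
    have := integral_pow_le_of_lintegral (hf.lintegral_pow_four_le hp)
    push_cast at this
    exact this
  have hmean : ∫ x : ℝ≥0, (x : ℝ) ^ 2 ∂F ≤ 20 * p ^ 2 := by
    have := integral_pow_le_of_lintegral (hf.lintegral_pow_two_le hp)
    push_cast at this
    exact this
  have hmem : MemLp (fun x : ℝ≥0 => (x : ℝ) ^ 2) 2 F := by
    rw [memLp_two_iff_integrable_sq (by fun_prop)]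
    simpa only [← pow_mul] using h4
  have hcheb := pi_real_chebyshev (k := k) F (g := fun x : ℝ≥0 => (x : ℝ) ^ 2) (by fun_prop) hmem
    (t := 20 * p ^ 2 * N) (by positivity) hsq
  refine (measure_mono fun w hw => ?_).trans (hcheb.trans (ENNReal.ofReal_le_ofReal ?_))
  · have hw' : 40 * p ^ 2 * N < ∑ j, (w j : ℝ) ^ 2 := hw
    simp only [Set.mem_ofPred_eq]
    refine le_trans ?_ (le_abs_self _)
    have : k * ∫ x : ℝ≥0, (x : ℝ) ^ 2 ∂F ≤ N * (20 * p ^ 2) :=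
      mul_le_mul hkN hmean (integral_nonneg fun x => by positivity) hN.le
    linarith
  · rw [div_le_div_iff₀ (by positivity) hN]
    have : (k : ℝ) * (1040 * p ^ 4) * N ≤ N * (1200 * p ^ 4) * N := by gcongr; norm_num
    linarith

end HasMHRDensity

/-- A bound on what the price can exceed a multiple of `p` by. -/
def priceExcess (p : ℝ≥0) (N : ℝ) {k : ℕ} (w : Fin k → ℝ≥0) : ℝ :=
  (∑ j, (w j : ℝ) ^ 4) / (Real.sqrt N * p) ^ 3 +
    Real.sqrt N * p * (Set.indicator
      {w : Fin k → ℝ≥0 | ((Finset.univ.filter fun j => p / 4 ≤ w j).card : ℝ) < N / 4} 1 w +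
    Set.indicator {w : Fin k → ℝ≥0 | 40 * p ^ 2 * N < ∑ j, (w j : ℝ) ^ 2} 1 w)

theorem priceExcess_nonneg (p : ℝ≥0) (N : ℝ) {k : ℕ} (w : Fin k → ℝ≥0) :
    0 ≤ priceExcess p N w := by
  unfold priceExcess
  have h1 : ∀ s : Set (Fin k → ℝ≥0), (0 : ℝ) ≤ s.indicator 1 w := fun s =>
    Set.indicator_nonneg (fun _ _ => zero_le_one) w
  have := h1 {w | ((Finset.univ.filter fun j => p / 4 ≤ w j).card : ℝ) < N / 4}
  have := h1 {w | 40 * p ^ 2 * N < ∑ j, (w j : ℝ) ^ 2}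
  positivity

theorem measurableSet_card_filter_lt {k : ℕ} (z : ℝ≥0) (x : ℝ) :
    MeasurableSet {w : Fin k → ℝ≥0 | ((Finset.univ.filter fun j => z ≤ w j).card : ℝ) < x} := by
  have h := measurable_card_filter_le (Finset.univ : Finset (Fin k)) z
  have h2 : Measurable fun w : Fin k → ℝ≥0 => ((Finset.univ.filter fun j => z ≤ w j).card : ℝ) := by
    have : (fun w : Fin k → ℝ≥0 => ((Finset.univ.filter fun j => z ≤ w j).card : ℝ)) =
        fun w => ((((Finset.univ : Finset (Fin k)).val.map w).filter (z ≤ ·)).card : ℝ) := by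
      ext w
      rw [Multiset.filter_map, Multiset.card_map]
      rfl
    rw [this]
    exact measurable_from_nat.comp h
  exact measurableSet_lt h2 measurable_const

theorem measurable_priceExcess (p : ℝ≥0) (N : ℝ) (k : ℕ) :
    Measurable (priceExcess p N (k := k)) := by
  unfold priceExcess
  have h1 := (measurable_one (α := ℝ)).indicator
    (measurableSet_card_filter_lt (k := k) (p / 4) (N / 4))
  have h2 := (measurable_one (α := ℝ)).indicator
    (measurableSet_lt (measurable_const (a := 40 * p ^ 2 * N))
    (show Measurable fun w : Fin k → ℝ≥0 => ∑ j, (w j : ℝ) ^ 2 by fun_prop))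
  exact Measurable.add (by fun_prop) ((h1.add h2).const_mul _)

/-- There are three ranges for the price: up to 1280p the first term suffices; up to √N p one of the
two bad events must occur; above √N p some entry of `w` is at least the price and its fourth power
pays for it. -/
theorem ERM_pool_mul_le {m k : ℕ} {c : ℝ} (hc : c ≤ 1 / 8) (a : Fin m → ℝ≥0) (w : Fin k → ℝ≥0)
    {p : ℝ≥0} (hp : 0 < p) {N : ℝ} (hN : N = (m + k : ℕ)) (hN0 : 0 < N)
    (hm : (m : ℝ) ≤ Real.sqrt N / 32) (hcm : (m : ℝ) ≤ c * N) {δ : ℝ} (hδ : 0 ≤ δ)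
    (hδ' : δ ≤ 1) :
    (ERM c (pool a w) : ℝ) * δ ≤ 1280 * p * δ + priceExcess p N w := by
  have hX := priceExcess_nonneg p N w
  have hp' : (0 : ℝ) < p := by exact_mod_cast hp
  have hsN : 0 < Real.sqrt N := Real.sqrt_pos.2 hN0
  set e : ℝ := ((ERM c (pool a w) : ℝ≥0) : ℝ) with he
  have he0 : 0 ≤ e := NNReal.coe_nonneg _
  by_cases h1 : e ≤ 1280 * p
  · have := mul_le_mul_of_nonneg_right h1 hδ
    linarith
  suffices h : e ≤ priceExcess p N w by
    have h3 : e * δ ≤ e := mul_le_of_le_one_right he0 hδ'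
    have h4 : 0 ≤ 1280 * p * δ := by positivity
    linarith
  have hind : ∀ s : Set (Fin k → ℝ≥0), (0 : ℝ) ≤ s.indicator 1 w := fun s =>
    Set.indicator_nonneg (fun _ _ => zero_le_one) w
  have hi1 := hind {w | ((Finset.univ.filter fun j => p / 4 ≤ w j).card : ℝ) < N / 4}
  have hi2 := hind {w | 40 * p ^ 2 * N < ∑ j, (w j : ℝ) ^ 2}
  have hq : 0 ≤ (∑ j, (w j : ℝ) ^ 4) / (Real.sqrt N * p) ^ 3 := by positivity
  unfold priceExcess
  by_cases h2 : e ≤ Real.sqrt N * p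
  · have hone : 1 ≤ Set.indicator
        {w : Fin k → ℝ≥0 | ((Finset.univ.filter fun j => p / 4 ≤ w j).card : ℝ) < N / 4} 1 w +
        Set.indicator {w : Fin k → ℝ≥0 | 40 * p ^ 2 * N < ∑ j, (w j : ℝ) ^ 2} (1 : (Fin k → ℝ≥0) → ℝ) w := by
      by_contra hcon
      refine h1 (ERM_pool_le_mul hc a w hp hN hN0 hm h2 ?_ ?_)
      · by_contra hlt
        rw [Set.indicator_of_mem (show w ∈ {w : Fin k → ℝ≥0 |
          ((Finset.univ.filter fun j => p / 4 ≤ w j).card : ℝ) < N / 4} from not_le.1 hlt)] at hcon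
        simp only [Pi.one_apply] at hcon
        linarith
      · by_contra hlt
        rw [Set.indicator_of_mem (s := {w : Fin k → ℝ≥0 | 40 * p ^ 2 * N < ∑ j, (w j : ℝ) ^ 2})
          (show w ∈ {w : Fin k → ℝ≥0 | 40 * p ^ 2 * N < ∑ j, (w j : ℝ) ^ 2}
            from not_le.1 hlt)] at hcon
        simp only [Pi.one_apply] at hcon
        linarith
    have := mul_le_mul_of_nonneg_left hone (show 0 ≤ Real.sqrt N * p by positivity)
    linarith
  · have hpos : 0 < ERM c (pool a w) := by
      have : 0 < e := lt_of_le_of_lt (by positivity) (not_le.1 h2)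
      exact_mod_cast this
    have hmk : 0 < m + k := by
      have : (0 : ℝ) < (m + k : ℕ) := hN ▸ hN0
      exact_mod_cast this
    obtain ⟨j, hj⟩ := exists_ERM_pool_le (by linarith) hmk (by rw [← hN]; exact hcm) a w hpos
    have hj' : e ≤ w j := by exact_mod_cast hj
    have h3 : e ≤ (∑ j, (w j : ℝ) ^ 4) / (Real.sqrt N * p) ^ 3 := by
      rw [le_div_iff₀ (by positivity)]
      calc e * (Real.sqrt N * p) ^ 3 ≤ e * e ^ 3 := by
            gcongr
            exact (not_le.1 h2).le
        _ = e ^ 4 := by ring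
        _ ≤ (w j : ℝ) ^ 4 := by gcongr
        _ ≤ _ := Finset.single_le_sum (f := fun j => (w j : ℝ) ^ 4)
          (fun j _ => by positivity) (Finset.mem_univ j)
    have : 0 ≤ Real.sqrt N * p * (Set.indicator
        {w : Fin k → ℝ≥0 | ((Finset.univ.filter fun j => p / 4 ≤ w j).card : ℝ) < N / 4} 1 w +
        Set.indicator {w : Fin k → ℝ≥0 | 40 * p ^ 2 * N < ∑ j, (w j : ℝ) ^ 2} 1 w) := by
      positivity
    linarith

/-- Fourth powers are the least integer powers for which N p^q / (√N p)^(q-1) is O(p/√N). The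
constant is 1040 + 25 + 3. -/
theorem lintegral_priceExcess_le {F : Measure ℝ≥0} [IsProbabilityMeasure F] {f : ℝ≥0 → ℝ≥0}
    {p : ℝ≥0} (hf : HasMHRDensity F f) (hp : IsMonopolyPrice F p) {k : ℕ} {N : ℝ}
    (hN : 0 < N) (hkN : k ≤ N) (hk : 31 / 32 * N ≤ k) :
    ∫⁻ w, ENNReal.ofReal (priceExcess p N w) ∂(Measure.pi fun _ : Fin k => F) ≤
      ENNReal.ofReal (1068 * (p / Real.sqrt N)) := by
  have hp0 : (0 : ℝ) < p := by exact_mod_cast (hf.monopoly_pos hp).1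
  have hsN : 0 < Real.sqrt N := Real.sqrt_pos.2 hN
  have hss : Real.sqrt N * Real.sqrt N = N := Real.mul_self_sqrt hN.le
  set s := Real.sqrt N with hs
  set A := {w : Fin k → ℝ≥0 | ((Finset.univ.filter fun j => p / 4 ≤ w j).card : ℝ) < N / 4} with hA
  set Q := {w : Fin k → ℝ≥0 | 40 * p ^ 2 * N < ∑ j, (w j : ℝ) ^ 2} with hQ
  have hAm : MeasurableSet A := measurableSet_card_filter_lt (p / 4) (N / 4)
  have hQm : MeasurableSet Q := measurableSet_lt measurable_const (by fun_prop)
  have hsplit : ∀ w, ENNReal.ofReal (priceExcess p N w) ≤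
      ENNReal.ofReal (1 / (s * p) ^ 3) * ENNReal.ofReal (∑ j, (w j : ℝ) ^ 4) +
        (ENNReal.ofReal (s * p) * A.indicator 1 w + ENNReal.ofReal (s * p) * Q.indicator 1 w) := by
    intro w
    have hind : ∀ B : Set (Fin k → ℝ≥0),
        ENNReal.ofReal (B.indicator 1 w) = B.indicator 1 w := by
      intro B
      by_cases hB : w ∈ B <;> simp [hB]
    unfold priceExcess
    refine ENNReal.ofReal_add_le.trans (add_le_add (le_of_eq ?_) ?_)
    · rw [← ENNReal.ofReal_mul (by positivity), div_mul_eq_mul_div, one_mul]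
    · rw [mul_add, ← hind A, ← hind Q, ← ENNReal.ofReal_mul (by positivity),
        ← ENNReal.ofReal_mul (by positivity)]
      exact ENNReal.ofReal_add_le
  have hA1 : Measurable fun w => ENNReal.ofReal (s * p) * A.indicator (1 : (Fin k → ℝ≥0) → ℝ≥0∞) w :=
    (measurable_one.indicator hAm).const_mul _
  calc _ ≤ _ := lintegral_mono hsplit
    _ = ENNReal.ofReal (1 / (s * p) ^ 3) *
          ∫⁻ w, ENNReal.ofReal (∑ j, (w j : ℝ) ^ 4) ∂(Measure.pi fun _ : Fin k => F) +
        (ENNReal.ofReal (s * p) * (Measure.pi fun _ : Fin k => F) A +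
          ENNReal.ofReal (s * p) * (Measure.pi fun _ : Fin k => F) Q) := by
        rw [lintegral_add_left (by fun_prop), lintegral_add_left hA1,
          lintegral_const_mul' _ _ ENNReal.ofReal_ne_top,
          lintegral_const_mul' _ _ ENNReal.ofReal_ne_top,
          lintegral_const_mul' _ _ ENNReal.ofReal_ne_top, lintegral_indicator_one hAm,
          lintegral_indicator_one hQm]
    _ ≤ ENNReal.ofReal (1 / (s * p) ^ 3) * ENNReal.ofReal (k * (1040 * p ^ 4)) +
        (ENNReal.ofReal (s * p) * ENNReal.ofReal (25 / N) +
          ENNReal.ofReal (s * p) * ENNReal.ofReal (3 / N)) := by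
        gcongr
        · exact hf.lintegral_sum_pow_four_le hp k
        · exact hf.pi_few_above_le hp hN hkN hk
        · exact hf.pi_large_sq_le hp hN hkN
    _ = ENNReal.ofReal (1 / (s * p) ^ 3 * (k * (1040 * p ^ 4)) +
          (s * p * (25 / N) + s * p * (3 / N))) := by
        rw [← ENNReal.ofReal_mul (by positivity), ← ENNReal.ofReal_mul (by positivity),
          ← ENNReal.ofReal_mul (by positivity), ← ENNReal.ofReal_add (by positivity)
          (by positivity), ← ENNReal.ofReal_add (by positivity) (by positivity)]
    _ ≤ _ := by
        refine ENNReal.ofReal_le_ofReal ?_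
        calc _ ≤ 1 / (s * p) ^ 3 * (N * (1040 * p ^ 4)) +
              (s * p * (25 / N) + s * p * (3 / N)) := by gcongr
          _ = 1068 * (p / s) := by
            rw [← hss]
            field_simp
            ring

theorem isPBIC_twoPhaseERM_of_isMHR {n T T₁ K m : ℕ} (hT₁ : 0 < T₁) (hT : T₁ ≤ T) (hK : 0 < K)
    (hmK : (m : ℝ) * K ≤ 1 / 32 * Real.sqrt ((T₁ : ℝ) * K)) (S : Schedule n T K)
    (hS : ∀ i, (S.rounds i).card ≤ m) {M : Auction K} (hM : M.Regular) (hM' : M.Truthful)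
    (τ : TieBreaking K) {c : ℝ} (hc : (m : ℝ) / T₁ ≤ c) (hc' : c ≤ 1 / (4 * Real.exp 1))
    (F : Measure ℝ≥0) [IsProbabilityMeasure F] (hF : IsMHR F) {p : ℝ≥0}
    (hp : IsMonopolyPrice F p) :
    S.IsPBIC (twoPhaseERM M τ T₁ c) F Set.univ
      (1280 * ((m : ℝ) * (p : ℝ) * worstDelta (ERM c) F (T₁ * K) (m * K)) +
        1068 * ((m : ℝ) * (p : ℝ) / Real.sqrt ((T₁ : ℝ) * K))) := by
  obtain ⟨f, h1, h2, h3⟩ := hF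
  have hf : HasMHRDensity F f := ⟨h1, h2, h3⟩
  have hp0 := (hf.monopoly_pos hp).1
  set N : ℝ := (T₁ : ℝ) * K with hN
  have hK' : (1 : ℝ) ≤ K := by exact_mod_cast hK
  have hT' : (1 : ℝ) ≤ T₁ := by exact_mod_cast hT₁
  have hN1 : 1 ≤ N := one_le_mul_of_one_le_of_one_le hT' hK'
  have hN0 : 0 < N := by linarith
  have hsN : Real.sqrt N ≤ N := Real.sqrt_le_self_iff.2 (Or.inr hN1)
  have hJ : (m : ℝ) * K ≤ N / 32 := by linarith
  have hm : m ≤ T₁ := by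
    have : (m : ℝ) * K ≤ T₁ * K := by linarith
    have := le_of_mul_le_mul_right this (by linarith)
    exact_mod_cast this
  have hle : m * K ≤ T₁ * K := Nat.mul_le_mul_right K hm
  have hNnat : N = (m * K + (T₁ * K - m * K) : ℕ) := by
    rw [Nat.add_sub_cancel' hle]
    push_cast
    rfl
  have hk : ((T₁ * K - m * K : ℕ) : ℝ) = N - m * K := by
    rw [Nat.cast_sub hle]
    push_cast
    rfl
  have hc8 : c ≤ 1 / 8 := by
    refine hc'.trans ?_
    have : (2 : ℝ) ≤ Real.exp 1 := by linarith [Real.add_one_le_exp (1 : ℝ)]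
    exact one_div_le_one_div_of_le (by norm_num) (by linarith)
  -- The guard `m / T₁ ≤ c`, multiplied by `N`, covers all `m * K` manipulable samples.
  have hcm : ((m * K : ℕ) : ℝ) ≤ c * N := by
    rw [div_le_iff₀ (by linarith)] at hc
    have := mul_le_mul_of_nonneg_right hc (show (0 : ℝ) ≤ K by linarith)
    push_cast
    rw [hN]
    linarith
  have hδ := worstDelta_nonneg (ERM c) F (T₁ * K) (m * K)
  have hmp : 0 ≤ (m : ℝ) * p := by positivity
  refine isPBIC_twoPhaseERM hT hm S hS hM hM' τ c (by positivity)
    (fun w => 1280 * p * worstIncentiveMeasure (ERM c) (m * K) w + priceExcess p N w)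
    (fun w => ?_) (fun v _ a b w => ?_) ?_
  · have := worstIncentiveMeasure_nonneg (ERM c) (m := m * K) w
    have := priceExcess_nonneg p N w
    positivity
  · have h0 := worstIncentiveMeasure_nonneg (ERM c) (m := m * K) w
    refine (min_sub_le_mul_worstIncentiveMeasure (ERM c) v a b w).trans ?_
    refine (mul_le_mul_of_nonneg_right (min_le_right _ _) h0).trans ?_
    exact ERM_pool_mul_le hc8 a w hp0 hNnat hN0 (by push_cast; linarith) hcm h0
      (worstIncentiveMeasure_le_one _ w)
  · have hX := lintegral_priceExcess_le hf hp (k := T₁ * K - m * K) hN0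
      (by rw [hk]; linarith [show (0 : ℝ) ≤ m * K by positivity]) (by rw [hk]; linarith)
    have hmeas : Measurable fun w : Fin (T₁ * K - m * K) → ℝ≥0 =>
        ENNReal.ofReal m * ENNReal.ofReal (priceExcess p N w) :=
      (measurable_priceExcess p N _).ennreal_ofReal.const_mul _
    have hsplit : ∀ w : Fin (T₁ * K - m * K) → ℝ≥0,
        ENNReal.ofReal (m * (1280 * p * worstIncentiveMeasure (ERM c) (m * K) w +
          priceExcess p N w)) =
        ENNReal.ofReal (1280 * (m * p)) * ENNReal.ofReal (worstIncentiveMeasure (ERM c) (m * K) w) +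
          ENNReal.ofReal m * ENNReal.ofReal (priceExcess p N w) := by
      intro w
      have h0 := worstIncentiveMeasure_nonneg (ERM c) (m := m * K) w
      have h0' := priceExcess_nonneg p N w
      rw [← ENNReal.ofReal_mul (by positivity), ← ENNReal.ofReal_mul (by positivity),
        ← ENNReal.ofReal_add (by positivity) (by positivity)]
      ring_nf
    simp_rw [hsplit]
    -- Only the summand with `priceExcess` has to be measurable here.
    rw [lintegral_add_right _ hmeas, lintegral_const_mul' _ _ ENNReal.ofReal_ne_top,
      lintegral_const_mul' _ _ ENNReal.ofReal_ne_top, ← ofReal_worstDelta]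
    refine (add_le_add_right (mul_le_mul_right hX _) _).trans_eq ?_
    rw [← ENNReal.ofReal_mul (by positivity), ← ENNReal.ofReal_mul (by positivity),
      ← ENNReal.ofReal_add (by positivity) (by positivity)]
    ring_nf

end RepAuction

end

theorem mainTheorem5 :
    -- bounded distributions
    (∀ (n T T₁ K m : ℕ), 0 < T₁ → T₁ ≤ T → 0 < K →
      ∀ (S : RepAuction.Schedule n T K), (∀ i, (S.rounds i).card ≤ m) →
      ∀ (M : RepAuction.Auction K), M.Regular → M.Truthful →
      ∀ (τ : RepAuction.TieBreaking K) (c : ℝ), 0 ≤ c → c < 1 →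
      ∀ (F : Measure ℝ≥0) [IsProbabilityMeasure F] (D : ℝ≥0), RepAuction.IsBoundedDist F D →
        S.IsPBIC (RepAuction.twoPhaseERM M τ T₁ c) F (Set.Icc 1 D)
          ((m : ℝ) * (D : ℝ) * RepAuction.worstDelta (RepAuction.ERM c) F (T₁ * K) (m * K))) ∧
    -- monotone hazard rate distributions
    (∀ (T₁ K m : ℕ → ℕ), (∀ a, 0 < T₁ a) → (∀ a, 0 < K a) →
      (fun a => (m a : ℝ) * (K a : ℝ)) =o[atTop]
        (fun a => Real.sqrt ((T₁ a : ℝ) * (K a : ℝ))) →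
      ∃ C₁ C₂ : ℝ, 0 < C₁ ∧ 0 < C₂ ∧ ∀ᶠ a in atTop,
        ∀ (n T : ℕ), T₁ a ≤ T →
        ∀ (S : RepAuction.Schedule n T (K a)), (∀ i, (S.rounds i).card ≤ m a) →
        ∀ (M : RepAuction.Auction (K a)), M.Regular → M.Truthful →
        ∀ (τ : RepAuction.TieBreaking (K a)) (c : ℝ),
          (m a : ℝ) / (T₁ a : ℝ) ≤ c → c ≤ 1 / (4 * Real.exp 1) →
        ∀ (F : Measure ℝ≥0) [IsProbabilityMeasure F], RepAuction.IsMHR F →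
        ∀ vstar : ℝ≥0, RepAuction.IsMonopolyPrice F vstar →
          S.IsPBIC (RepAuction.twoPhaseERM M τ (T₁ a) c) F Set.univ
            (C₁ * ((m a : ℝ) * (vstar : ℝ) *
                RepAuction.worstDelta (RepAuction.ERM c) F (T₁ a * K a) (m a * K a)) +
              C₂ * ((m a : ℝ) * (vstar : ℝ) / Real.sqrt ((T₁ a : ℝ) * (K a : ℝ))))) := by
  refine ⟨fun n T T₁ K m hT₁ hT hK S hS M hM hM' τ c _ hc F _ D _ =>
    RepAuction.isPBIC_twoPhaseERM_of_bounded hT₁ hT hK S hS hM hM' τ hc F D, ?_⟩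
  intro T₁ K m hT₁ hK ho
  refine ⟨1280, 1068, by norm_num, by norm_num, ?_⟩
  -- The asymptotic hypothesis enters only through mK ≤ √(T₁K)/32, so the starting point is
  -- independent of F and c.
  filter_upwards [ho.bound (show (0 : ℝ) < 1 / 32 by norm_num)] with a ha
  intro n T hT S hS M hM hM' τ c hc hc' F _ hF p hp
  rw [Real.norm_of_nonneg (by positivity), Real.norm_of_nonneg (by positivity)] at ha
  exact RepAuction.isPBIC_twoPhaseERM_of_isMHR (hT₁ a) hT (hK a) ha S hS hM hM' τ hc hc' F hF hp
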